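/- Let $(X,\omega)$ be a connected, compact Kähler manifold of complex dimension $n$, let $C^\infty(X)$ be the Fréchet space of smooth functions $X\to\mathbb R$, put $d^c=i(\bar\partial-\partial)/2$ (so $dd^c=i\partial\bar\partial$), and let $$\mathcal H=\{u\in C^\infty(X):\ \omega_u:=\omega+dd^cu>0\}$$ be the space of relative Kähler potentials, a Fréchet manifold as an open subset of $C^\infty(X)$, with tangent bundle $T\mathcal H=\mathcal H\times C^\infty(X)$ and fibers $T_u\mathcal H=\{u\}\times C^\infty(X)$. For $u\in\mathcal H$ let $\mu_u$ be the measure on $X$ induced by $\omega_u^n$. Let $L:T\mathcal H\to\mathbb R$ be an invariant convex Lagrangian, that is, a function such that 1. for each $u\in\mathcal H$ the restriction $L|_{T_u\mathcal H}$ is continuous on $C^\infty(X)$ and convex; 2. $L$ is invariant under strict rearrangements: if $u,v\in\mathcal H$, $\xi\in T_u\mathcal H$, $\eta\in T_v\mathcal H$ and $\mu_u(\xi^{-1}(B))=\mu_v(\eta^{-1}(B))$ for every Borel set $B\subset\mathbb R$, then $L(\xi)=L(\eta)$. Then $L$ is continuous on the Fréchet manifold $T\mathcal H$. -/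

import Mathlib

open scoped Manifold ContDiff Topology

noncomputable section

namespace KahlerPotentials

/-- The model space `ℂⁿ`. -/
abbrev Cn (n : ℕ) : Type := EuclideanSpace ℂ (Fin n)

section Forms

variable (n : ℕ) (X : Type*) [TopologicalSpace X] [ChartedSpace (Cn n) X]

/-- The space `C^∞(X)` of smooth real valued functions on `X`. -/
abbrev SmoothFun : Type _ := C^∞⟮𝓘(ℝ, Cn n), X; 𝓘(ℝ, ℝ), ℝ⟯

/-- Real differential `k`-forms on `X` (no regularity imposed). -/
abbrev DiffForm (k : ℕ) : Type _ := ∀ x : X, (TangentSpace 𝓘(ℝ, Cn n) x) [⋀^Fin k]→L[ℝ] ℝ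

variable {n X}

/-- The complex structure `J` of the tangent space `T_x X`: multiplication by `i`. (The real tangent
space is identified with `ℂⁿ` through the preferred holomorphic chart at `x`.) -/
def cplxJ (x : X) : TangentSpace 𝓘(ℝ, Cn n) x →L[ℝ] TangentSpace 𝓘(ℝ, Cn n) x :=
  ((Complex.I • ContinuousLinearMap.id ℂ (Cn n)).restrictScalars ℝ : Cn n →L[ℝ] Cn n)

/-- The expression of a form in a chart `e`: the pullback of `α` by `e⁻¹`, a form on the open set
`e.target ⊆ ℂⁿ`. -/
def inChart {k : ℕ} (e : OpenPartialHomeomorph X (Cn n)) (α : DiffForm n X k) (y : Cn n) :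
    (Cn n) [⋀^Fin k]→L[ℝ] ℝ :=
  (α (e.symm y)).compContinuousLinearMap
    (mfderiv 𝓘(ℝ, Cn n) 𝓘(ℝ, Cn n) e.symm y :
      Cn n →L[ℝ] TangentSpace 𝓘(ℝ, Cn n) (e.symm y))

/-- A form is smooth if its expressions in all charts are smooth. -/
def IsSmoothForm {k : ℕ} (α : DiffForm n X k) : Prop :=
  ∀ e ∈ atlas (Cn n) X, ContDiffOn ℝ ∞ (inChart e α) e.target

/-- The exterior derivative `dα`: at `x`, differentiate the expression of `α` in the preferred
chart at `x`, and pull the result back to `X` by the chart. -/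
def extD {k : ℕ} (α : DiffForm n X k) : DiffForm n X (k + 1) := fun x =>
  (extDeriv (inChart (chartAt (Cn n) x) α) (chartAt (Cn n) x x)).compContinuousLinearMap
    (mfderiv 𝓘(ℝ, Cn n) 𝓘(ℝ, Cn n) (chartAt (Cn n) x) x :
      TangentSpace 𝓘(ℝ, Cn n) x →L[ℝ] Cn n)

/-- `d^c u = i(∂̄ - ∂)u/2`. Since `∂̄u - ∂u = i du ∘ J` for the complex structure `J`, this is the
real 1-form `-(1/2) du ∘ J`. -/
def dc (u : SmoothFun n X) : DiffForm n X 1 := fun x =>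
  ContinuousAlternatingMap.ofSubsingleton ℝ (TangentSpace 𝓘(ℝ, Cn n) x) ℝ (0 : Fin 1)
    ((-(1 / 2) : ℝ) •
      ((mfderiv 𝓘(ℝ, Cn n) 𝓘(ℝ, ℝ) u x : TangentSpace 𝓘(ℝ, Cn n) x →L[ℝ] ℝ).comp (cplxJ x)))

/-- `dd^c u = i∂∂̄u`. -/
def ddc (u : SmoothFun n X) : DiffForm n X 2 := extD (dc u)

/-- Positivity of a real 2-form of type `(1,1)`: `α(v, Jv) > 0` for all tangent vectors `v ≠ 0`. -/
def IsPositive (α : DiffForm n X 2) : Prop :=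
  ∀ (x : X) (v : TangentSpace 𝓘(ℝ, Cn n) x), v ≠ 0 → 0 < α x ![v, cplxJ x v]

variable (n X) in
/-- A Kähler form on the complex manifold `X`: a smooth, closed, positive real form of type
`(1,1)`, i.e. invariant under `J`. -/
structure KahlerForm where
  form : DiffForm n X 2
  smooth : IsSmoothForm form
  closed : ∀ x, extD form x = 0
  typeOneOne : ∀ (x : X) (v w : TangentSpace 𝓘(ℝ, Cn n) x),
    form x ![cplxJ x v, cplxJ x w] = form x ![v, w]
  positive : IsPositive form

/-- `ω_u = ω + dd^c u`. -/
def KahlerForm.twist (Ω : KahlerForm n X) (u : SmoothFun n X) : DiffForm n X 2 :=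
  Ω.form + ddc u

/-- The space `𝓗 = {u ∈ C^∞(X) : ω_u > 0}` of relative Kähler potentials. -/
def KahlerForm.potentials (Ω : KahlerForm n X) : Set (SmoothFun n X) :=
  {u | IsPositive (Ω.twist u)}

/-- The tangent bundle `T𝓗` in its canonical trivialization `𝓗 × C^∞(X)`. -/
abbrev KahlerForm.TH (Ω : KahlerForm n X) : Type _ := ↥Ω.potentials × SmoothFun n X

/-- The `C^∞` topology on `C^∞(X)`: uniform convergence, on the compact subsets of every chart, of
all partial derivatives of every order. The set `𝓗 ⊆ C^∞(X)` gets the subspace topology and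
`T𝓗 = 𝓗 × C^∞(X)` the product topology. -/
instance smoothTopology : TopologicalSpace (SmoothFun n X) :=
  ⨅ e ∈ atlas (Cn n) X, ⨅ k : ℕ,
    TopologicalSpace.induced
      (fun f : SmoothFun n X =>
        UniformOnFun.ofFun {K : Set (Cn n) | IsCompact K ∧ K ⊆ e.target}
          (iteratedFDeriv ℝ k (fun y : Cn n => f (e.symm y))))
      inferInstance

end Forms

section Measures

open MeasureTheory

/-- The value `αⁿ(v)` of the `n`-fold exterior power of an alternating 2-form `α` on `2n` vectors
`v_{(0,0)}, v_{(0,1)}, v_{(1,0)}, v_{(1,1)}, …, v_{(n-1,0)}, v_{(n-1,1)}` (in this order). -/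
def topPower {T : Type*} [AddCommGroup T] [Module ℝ T] [TopologicalSpace T] (n : ℕ)
    (α : T [⋀^Fin 2]→L[ℝ] ℝ) (v : Fin n × Fin 2 → T) : ℝ :=
  ((2 : ℝ) ^ n)⁻¹ * ∑ σ : Equiv.Perm (Fin n × Fin 2),
    ((Equiv.Perm.sign σ : ℤ) : ℝ) * ∏ j : Fin n, α ![v (σ (j, 0)), v (σ (j, 1))]

/-- The standard positively oriented real basis `e₁, ie₁, …, eₙ, ieₙ` of `ℂⁿ`; it is orthonormal,
so that it spans a parallelepiped of Lebesgue measure 1. -/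
def stdFrame (n : ℕ) (p : Fin n × Fin 2) : Cn n :=
  EuclideanSpace.single p.1 (if p.2 = 0 then 1 else Complex.I)

variable {n : ℕ} {X : Type*} [TopologicalSpace X] [ChartedSpace (Cn n) X]
  [MeasurableSpace X]

/-- The measure that the top form `αⁿ` induces on the domain of the chart `e` (extended by zero
to `X`): in the coordinates given by `e` it is Lebesgue measure times the coefficient of `αⁿ`. -/
def chartMeasure (e : OpenPartialHomeomorph X (Cn n)) (α : DiffForm n X 2) : Measure X :=
  ((volume.restrict e.target).withDensity
    (fun y => ENNReal.ofReal (topPower n (inChart e α y) (stdFrame n)))).map e.symm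

/-- The measure on `X` induced by `αⁿ`, for a smooth positive `(1,1)`-form `α`. The measures
`chartMeasure e α` are its restrictions to the chart domains, and therefore their supremum in the
lattice of measures is the measure on all of `X` (see `topMeasure_eq` below). -/
def topMeasure (α : DiffForm n X 2) : Measure X :=
  ⨆ e ∈ atlas (Cn n) X, chartMeasure e α

/-- The measure of `X` is glued from the measures of the chart domains: if the restrictions of `μ`
to the chart domains are the measures given by `αⁿ` in the charts, then `topMeasure α = μ`. -/
theorem topMeasure_eq [BorelSpace X] [CompactSpace X] (α : DiffForm n X 2) (μ : Measure X)
    (h : ∀ e ∈ atlas (Cn n) X, chartMeasure e α = μ.restrict e.source) : topMeasure α = μ := by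
  have hle : topMeasure α ≤ μ := iSup₂_le fun e he => (h e he).trans_le Measure.restrict_le_self
  obtain ⟨t, ht⟩ := isCompact_univ.elim_nhds_subcover (fun x : X => (chartAt (Cn n) x).source)
    fun x _ => chart_source_mem_nhds _ x
  have hU : (⋃ x : t, (chartAt (Cn n) (x : X)).source) = Set.univ := by
    ext y
    simpa using ht.2 (Set.mem_univ y)
  rw [Measure.ext_iff_of_iUnion_eq_univ hU]
  intro x
  refine le_antisymm (Measure.restrict_mono subset_rfl hle) ?_
  have h2 : μ.restrict (chartAt (Cn n) (x : X)).source ≤ topMeasure α := by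
    rw [← h _ (chart_mem_atlas (Cn n) (x : X))]
    exact le_iSup₂ (f := fun e _ => chartMeasure e α) _ (chart_mem_atlas _ _)
  calc μ.restrict (chartAt (Cn n) (x : X)).source
      = (μ.restrict (chartAt (Cn n) (x : X)).source).restrict
          (chartAt (Cn n) (x : X)).source := by
        rw [Measure.restrict_restrict (chartAt (Cn n) (x : X)).open_source.measurableSet,
          Set.inter_self]
    _ ≤ _ := Measure.restrict_mono subset_rfl h2

/-- The measure `μ_u` induced by `ω_uⁿ`. -/
def KahlerForm.measure (Ω : KahlerForm n X) (u : SmoothFun n X) : Measure X :=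
  topMeasure (Ω.twist u)

/-- `ξ` on `(X, μ)` and `η` on `(Y, ν)` are equidistributed, or strict rearrangements of each
other. -/
def Equidistributed {X Y : Type*} [MeasurableSpace X] [MeasurableSpace Y] (μ : Measure X)
    (ν : Measure Y) (ξ : X → ℝ) (η : Y → ℝ) : Prop :=
  ∀ B : Set ℝ, MeasurableSet B → μ (ξ ⁻¹' B) = ν (η ⁻¹' B)

/-- An invariant convex Lagrangian: a function `T𝓗 → ℝ` that is continuous and convex on each
fiber `T_u 𝓗`, and invariant under strict rearrangements. -/
structure IsInvariantConvexLagrangian (Ω : KahlerForm n X) (L : Ω.TH → ℝ) : Prop where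
  continuous_fiber : ∀ u : Ω.potentials, Continuous fun ξ : SmoothFun n X => L (u, ξ)
  convex_fiber : ∀ u : Ω.potentials,
    ConvexOn ℝ Set.univ fun ξ : SmoothFun n X => L (u, ξ)
  invariant : ∀ (u v : Ω.potentials) (ξ η : SmoothFun n X),
    Equidistributed (Ω.measure u) (Ω.measure v) ξ η → L (u, ξ) = L (v, η)

end Measures

end KahlerPotentials

end

noncomputable section

open Set Filter

/-! Continuity of `L` at (u₀, ξ₀) reduces to continuity on the single fibre over u₀. Suppose that
for (u, ξ) near (u₀, ξ₀) there is a function η(u, ξ) on the fixed measure space (X, μ_{u₀}) that is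
equidistributed with ξ on (X, μ_u) and depends continuously on (u, ξ) in C^∞(X). Then L(u, ξ) =
L(u₀, η(u, ξ)) by invariance, and the right side is continuous. This is
`exists_equidistributed_nhds`.

Such an η is ξ ∘ Φ with Φ a map that pushes μ_{u₀} to μ_u, so a Moser theorem with parameters is
needed. Instead of integrating a flow, Φ is built explicitly. A partition of unity splits u - u₀
into pieces w supported in charts, treated one after the other (`exists_equidistributed_add`). In a
chart ω_{v+w} - ω_v = d(d^c w), and both forms are closed, so the two densities differ by the
divergence of a vector field supported where w is (`topPower_sub_eq_divergence`, `density_add`). The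
terms of the divergence are added one direction at a time. To turn f dx into (f + ∂_e g) dx, let F
be a primitive of f along e. The shear that replaces the coordinate along e by F has Jacobian f,
hence carries f dx to Lebesgue measure. Following it by the inverse of the shear of F + g gives the
required map, which is the identity where g vanishes (`exists_map_withDensity_dir`).

The method needs every intermediate density to be positive. At u = u₀ they all equal the density of
ω_{u₀}ⁿ, which is positive because a positive (1,1)-form has positive top power (`topPower_pos`);
compactness extends this to u near u₀.

Continuity of a family in C^∞(X) means that all its derivatives in charts are jointly continuous in
parameter and point (`continuous_smoothFun_iff`). The whole construction is therefore carried out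
within that class of families, which is closed under composition, inversion and integration. -/

lemma slice_mem_nhds {T E : Type*} [TopologicalSpace T] [TopologicalSpace E] {W : Set (T × E)}
    (hW : IsOpen W) {p : T × E} (hp : p ∈ W) : {x | (p.1, x) ∈ W} ∈ 𝓝 p.2 :=
  (hW.preimage (by fun_prop : Continuous fun x : E => (p.1, x))).mem_nhds hp

/-! ### Calculus of smooth families over a topological parameter space -/

section ParamContDiff

variable {S T : Type*} [TopologicalSpace S] [TopologicalSpace T]
  {E F G H : Type} [NormedAddCommGroup E] [NormedSpace ℝ E] [NormedAddCommGroup F]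
  [NormedSpace ℝ F] [NormedAddCommGroup G] [NormedSpace ℝ G] [NormedAddCommGroup H]
  [NormedSpace ℝ H]

/-- A family `f t : E → F` is `k` times differentiable on the slices of the set `W ⊆ T × E`, and the
derivatives of order at most `k` are jointly continuous on `W`. -/
def ParamContDiffOn : ∀ (_ : ℕ) {F : Type} [NormedAddCommGroup F] [NormedSpace ℝ F],
    (T → E → F) → Set (T × E) → Prop
  | 0, _, _, _, f, W => ContinuousOn (fun p : T × E => f p.1 p.2) W
  | k + 1, _, _, _, f, W => ContinuousOn (fun p : T × E => f p.1 p.2) W ∧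
      (∀ p ∈ W, DifferentiableAt ℝ (f p.1) p.2) ∧
      ParamContDiffOn k (fun t x => fderiv ℝ (f t) x) W

/-- A family `f t : E → F` all of whose derivatives exist and are jointly continuous on `W`. -/
def ParamSmoothOn (f : T → E → F) (W : Set (T × E)) : Prop :=
  ∀ k, ParamContDiffOn k f W

namespace ParamContDiffOn

variable {k : ℕ} {f g : T → E → F} {W W' : Set (T × E)}

lemma continuousOn (h : ParamContDiffOn k f W) :
    ContinuousOn (fun p : T × E => f p.1 p.2) W := by
  cases k with
  | zero => exact h
  | succ k => exact h.1

lemma mono (h : ParamContDiffOn k f W) (hW : W' ⊆ W) : ParamContDiffOn k f W' := by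
  induction k generalizing F with
  | zero => exact ContinuousOn.mono h hW
  | succ k ih => exact ⟨h.1.mono hW, fun p hp => h.2.1 p (hW hp), ih h.2.2⟩

lemma of_succ (h : ParamContDiffOn (k + 1) f W) : ParamContDiffOn k f W := by
  induction k generalizing F with
  | zero => exact h.1
  | succ k ih => exact ⟨h.1, h.2.1, ih h.2.2⟩

lemma congr (hW : IsOpen W) (h : ParamContDiffOn k f W)
    (hfg : ∀ p ∈ W, g p.1 p.2 = f p.1 p.2) : ParamContDiffOn k g W := by
  have key : ∀ p ∈ W, g p.1 =ᶠ[𝓝 p.2] f p.1 := fun p hp => by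
    filter_upwards [slice_mem_nhds hW hp] with x hx using hfg _ hx
  induction k generalizing F with
  | zero => exact ContinuousOn.congr h hfg
  | succ k ih =>
    refine ⟨h.1.congr hfg, fun p hp => (h.2.1 p hp).congr_of_eventuallyEq (key p hp),
      ih h.2.2 (fun p hp => (key p hp).fderiv_eq) fun p hp => (key p hp).fderiv⟩

lemma of_local (h : ∀ p ∈ W, ∃ W', IsOpen W' ∧ p ∈ W' ∧ ParamContDiffOn k f W') :
    ParamContDiffOn k f W := by
  induction k generalizing F with
  | zero =>
    intro p hp
    obtain ⟨W', hW', hpW', h'⟩ := h p hp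
    exact ((h'.continuousOn p hpW').continuousAt (hW'.mem_nhds hpW')).continuousWithinAt
  | succ k ih =>
    refine ⟨fun p hp => ?_, fun p hp => ?_, ih fun p hp => ?_⟩ <;>
    obtain ⟨W', hW', hpW', h'⟩ := h p hp
    · exact ((h'.continuousOn p hpW').continuousAt (hW'.mem_nhds hpW')).continuousWithinAt
    · exact h'.2.1 p hpW'
    · exact ⟨W', hW', hpW', h'.2.2⟩

lemma zero : ParamContDiffOn k (fun (_ : T) (_ : E) => (0 : F)) W := by
  induction k generalizing F with
  | zero => exact continuousOn_const
  | succ k ih => exact ⟨continuousOn_const, fun p _ => differentiableAt_const _, by simpa using ih⟩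

lemma of_param {c : T → F} (hc : Continuous c) :
    ParamContDiffOn k (fun (t : T) (_ : E) => c t) W := by
  cases k with
  | zero => exact (hc.comp continuous_fst).continuousOn
  | succ k =>
    exact ⟨(hc.comp continuous_fst).continuousOn, fun p _ => differentiableAt_const _,
      by simpa using zero⟩

lemma add (hf : ParamContDiffOn k f W) (hg : ParamContDiffOn k g W) (hW : IsOpen W) :
    ParamContDiffOn k (fun t x => f t x + g t x) W := by
  induction k generalizing F with
  | zero => exact ContinuousOn.add hf hg
  | succ k ih =>
    exact ⟨hf.1.add hg.1, fun p hp => (hf.2.1 p hp).add (hg.2.1 p hp),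
      (ih hf.2.2 hg.2.2).congr hW fun p hp => fderiv_fun_add (hf.2.1 p hp) (hg.2.1 p hp)⟩

lemma clm_comp (L : F →L[ℝ] G) (hf : ParamContDiffOn k f W) (hW : IsOpen W) :
    ParamContDiffOn k (fun t x => L (f t x)) W := by
  induction k generalizing F G with
  | zero => exact L.continuous.comp_continuousOn hf
  | succ k ih =>
    exact ⟨L.continuous.comp_continuousOn hf.1,
      fun p hp => L.differentiableAt.comp p.2 (hf.2.1 p hp),
      (ih (ContinuousLinearMap.compL ℝ E F G L) hf.2.2).congr hW
        fun p hp => (L.hasFDerivAt.comp p.2 (hf.2.1 p hp).hasFDerivAt).fderiv⟩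

/-- The Leibniz rule expresses the derivative by two bilinear maps with values in `E →L[ℝ] H`, so
the induction has to range over all target spaces. -/
lemma bilinear (B : F →L[ℝ] G →L[ℝ] H) {g : T → E → G} (hf : ParamContDiffOn k f W)
    (hg : ParamContDiffOn k g W) (hW : IsOpen W) :
    ParamContDiffOn k (fun t x => B (f t x) (g t x)) W := by
  have hB := B.isBoundedBilinearMap.continuous
  induction k generalizing F G H with
  | zero => exact hB.comp_continuousOn (ContinuousOn.prodMk hf hg)
  | succ k ih =>
    refine ⟨hB.comp_continuousOn (hf.1.prodMk hg.1), fun p hp =>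
      (B.hasFDerivAt_of_bilinear (hf.2.1 p hp).hasFDerivAt
        (hg.2.1 p hp).hasFDerivAt).differentiableAt, ?_⟩
    refine ParamContDiffOn.congr hW (ParamContDiffOn.add
      (ih (B.precompR E) hf.of_succ hg.2.2 (B.precompR E).isBoundedBilinearMap.continuous)
      (ih (B.precompL E) hf.2.2 hg.of_succ (B.precompL E).isBoundedBilinearMap.continuous) hW) ?_
    exact fun p hp => B.fderiv_of_bilinear (hf.2.1 p hp) (hg.2.1 p hp)

lemma comp {f : T → F → G} {φ : T → E → F} {V : Set (T × F)} (hf : ParamContDiffOn k f V)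
    (hφ : ParamContDiffOn k φ W) (hW : IsOpen W)
    (hm : ∀ p ∈ W, (p.1, φ p.1 p.2) ∈ V) :
    ParamContDiffOn k (fun t x => f t (φ t x)) W := by
  have hc : ∀ {G : Type} [NormedAddCommGroup G] [NormedSpace ℝ G] {f : T → F → G},
      ContinuousOn (fun p : T × F => f p.1 p.2) V →
      ContinuousOn (fun p : T × E => f p.1 (φ p.1 p.2)) W := fun h =>
    h.comp (continuous_fst.continuousOn.prodMk hφ.continuousOn) hm
  induction k generalizing G with
  | zero => exact hc hf
  | succ k ih =>
    refine ⟨hc hf.1, fun p hp => (hf.2.1 _ (hm p hp)).comp p.2 (hφ.2.1 p hp), ?_⟩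
    refine ParamContDiffOn.congr hW (ParamContDiffOn.bilinear (ContinuousLinearMap.compL ℝ E F G)
      (ih hf.2.2 hφ.of_succ) hφ.2.2 hW) ?_
    exact fun p hp => fderiv_comp p.2 (hf.2.1 _ (hm p hp)) (hφ.2.1 p hp)

/-- Families may be reparametrised by any continuous map. This allows an integration variable to be
added to the parameters. -/
lemma comp_param {f : T → E → F} {θ : S → T} (hθ : Continuous θ) (hf : ParamContDiffOn k f W) :
    ParamContDiffOn k (fun s x => f (θ s) x) ((fun p : S × E => (θ p.1, p.2)) ⁻¹' W) := by
  have hc : ∀ {F : Type} [NormedAddCommGroup F] [NormedSpace ℝ F] {f : T → E → F},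
      ContinuousOn (fun p : T × E => f p.1 p.2) W →
      ContinuousOn (fun p : S × E => f (θ p.1) p.2) ((fun p : S × E => (θ p.1, p.2)) ⁻¹' W) :=
    fun h => ContinuousOn.comp (f := fun p : S × E => (θ p.1, p.2)) h (by fun_prop) fun p hp => hp
  induction k generalizing F with
  | zero => exact hc hf
  | succ k ih => exact ⟨hc hf.1, fun p hp => hf.2.1 _ hp, ih hf.2.2⟩

lemma of_contDiffOn {f : E → F} {U : Set E} (hU : IsOpen U) (hf : ContDiffOn ℝ ∞ f U) :
    ParamContDiffOn k (fun _ : T => f) {p | p.2 ∈ U} := by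
  induction k generalizing F with
  | zero => exact hf.continuousOn.comp continuousOn_snd fun p hp => hp
  | succ k ih =>
    refine ⟨hf.continuousOn.comp continuousOn_snd fun p hp => hp, fun p hp =>
      (hf.contDiffAt (hU.mem_nhds hp)).differentiableAt (by simp), ih ?_⟩
    exact hf.fderiv_of_isOpen hU (by simp)

lemma contDiffOn_comp {g : F → G} {U : Set F} (hU : IsOpen U) (hg : ContDiffOn ℝ ∞ g U)
    (hf : ParamContDiffOn k f W) (hW : IsOpen W) (hm : ∀ p ∈ W, f p.1 p.2 ∈ U) :
    ParamContDiffOn k (fun t x => g (f t x)) W :=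
  (of_contDiffOn (T := T) hU hg).comp hf hW hm

lemma of_contDiff {f : E → F} (hf : ContDiff ℝ ∞ f) : ParamContDiffOn k (fun _ : T => f) W :=
  (of_contDiffOn isOpen_univ hf.contDiffOn).mono fun _ _ => mem_univ _

lemma sum {ι : Type*} {s : Finset ι} {f : ι → T → E → F}
    (hf : ∀ i ∈ s, ParamContDiffOn k (f i) W) (hW : IsOpen W) :
    ParamContDiffOn k (fun t x => ∑ i ∈ s, f i t x) W := by
  classical
  induction s using Finset.induction_on with
  | empty => simpa using zero
  | insert i s hi ih =>
    simp only [Finset.sum_insert hi]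
    exact (hf i (by simp)).add (ih fun j hj => hf j (by simp [hj])) hW

lemma mul {f g : T → E → ℝ} (hf : ParamContDiffOn k f W) (hg : ParamContDiffOn k g W)
    (hW : IsOpen W) : ParamContDiffOn k (fun t x => f t x * g t x) W :=
  hf.bilinear (ContinuousLinearMap.mul ℝ ℝ) hg hW

lemma smul {f : T → E → ℝ} {g : T → E → F} (hf : ParamContDiffOn k f W)
    (hg : ParamContDiffOn k g W) (hW : IsOpen W) :
    ParamContDiffOn k (fun t x => f t x • g t x) W :=
  hf.bilinear (ContinuousLinearMap.lsmul ℝ ℝ) hg hW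

lemma prod {ι : Type*} {s : Finset ι} {f : ι → T → E → ℝ}
    (hf : ∀ i ∈ s, ParamContDiffOn k (f i) W) (hW : IsOpen W) :
    ParamContDiffOn k (fun t x => ∏ i ∈ s, f i t x) W := by
  classical
  induction s using Finset.induction_on with
  | empty => simpa using of_contDiff contDiff_const
  | insert i s hi ih =>
    simp only [Finset.prod_insert hi]
    exact (hf i (by simp)).mul (ih fun j hj => hf j (by simp [hj])) hW

lemma sub (hf : ParamContDiffOn k f W) (hg : ParamContDiffOn k g W) (hW : IsOpen W) :
    ParamContDiffOn k (fun t x => f t x - g t x) W := by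
  have h := hf.add (hg.clm_comp (-ContinuousLinearMap.id ℝ F) hW) hW
  simpa [sub_eq_add_neg] using h

lemma contDiffOn_slice (hW : IsOpen W) (hf : ParamContDiffOn k f W) (t : T) :
    ContDiffOn ℝ k (f t) {x | (t, x) ∈ W} := by
  have hO : IsOpen {x | (t, x) ∈ W} := hW.preimage (by fun_prop)
  induction k generalizing F with
  | zero =>
    exact contDiffOn_zero.2
      (hf.continuousOn.comp (f := fun x => (t, x)) (by fun_prop) fun x hx => hx)
  | succ k ih =>
    refine (contDiffOn_succ_iff_fderiv_of_isOpen hO).2 ⟨fun x hx =>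
      (hf.2.1 (t, x) hx).differentiableWithinAt, by simp, ih hf.2.2⟩

lemma continuousOn_iteratedFDeriv (hf : ParamContDiffOn k f W) :
    ContinuousOn (fun p : T × E => iteratedFDeriv ℝ k (f p.1) p.2) W := by
  induction k generalizing F with
  | zero =>
    simp only [iteratedFDeriv_zero_eq_comp, Function.comp_def]
    exact (LinearIsometryEquiv.continuous _).comp_continuousOn hf.continuousOn
  | succ k ih =>
    simp only [iteratedFDeriv_succ_eq_comp_right, Function.comp_def]
    exact (LinearIsometryEquiv.continuous _).comp_continuousOn (ih hf.2.2)

/-- A family of inverses of a smooth family of maps with invertible derivatives is smooth as soon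
as it is continuous. -/
lemma of_leftInverse [CompleteSpace E] {A : T → E → F} {N : T → F → E}
    (hA : ParamContDiffOn k A univ) (hN : Continuous fun p : T × F => N p.1 p.2)
    (hAN : ∀ t y, A t (N t y) = y)
    (hinv : ∀ t x, ∃ L : E ≃L[ℝ] F, fderiv ℝ (A t) x = L) :
    ParamContDiffOn k N univ := by
  induction k with
  | zero => exact hN.continuousOn
  | succ k ih =>
    -- The derivative of the inverse is `(A')⁻¹ ∘ N`, and inversion is smooth on the open set of
    -- invertible maps. So each order of regularity of `N` yields the next one.
    have hd : ∀ t y, HasFDerivAt (N t) (ContinuousLinearMap.inverse (fderiv ℝ (A t) (N t y))) y := by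
      intro t y
      obtain ⟨L, hL⟩ := hinv t (N t y)
      rw [hL, ContinuousLinearMap.inverse_equiv]
      refine HasFDerivAt.of_local_left_inverse (f := A t)
        (hN.comp (Continuous.prodMk_right t)).continuousAt ?_ (Eventually.of_forall (hAN t))
      rw [← hL]
      exact (hA.2.1 (t, N t y) (mem_univ _)).hasFDerivAt
    refine ⟨hN.continuousOn, fun p _ => (hd p.1 p.2).differentiableAt, ?_⟩
    have h1 : ParamContDiffOn k (fun t y => fderiv ℝ (A t) (N t y)) univ :=
      hA.2.2.comp (ih hA.of_succ) isOpen_univ fun _ _ => mem_univ _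
    refine (h1.contDiffOn_comp (g := ContinuousLinearMap.inverse)
      (U := range ((↑) : (E ≃L[ℝ] F) → E →L[ℝ] F)) (ContinuousLinearEquiv.isOpen) ?_ isOpen_univ
      ?_).congr isOpen_univ fun p _ => (hd p.1 p.2).fderiv
    · rintro _ ⟨L, rfl⟩
      exact (contDiffAt_map_inverse L).contDiffWithinAt
    · intro p _
      obtain ⟨L, hL⟩ := hinv p.1 (N p.1 p.2)
      exact ⟨L, hL.symm⟩

/-- Differentiation under the integral sign: the derivative of the integrand is jointly continuous,
hence bounded on the compact product of the interval with a closed ball, and the bound is a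
dominating constant. -/
lemma intervalIntegral [FiniteDimensional ℝ E] [CompleteSpace F] {f : T × ℝ → E → F} {a b : ℝ}
    (hf : ParamContDiffOn k f univ) :
    ParamContDiffOn k (fun t x => ∫ τ in a..b, f (t, τ) x) univ := by
  have hc : ∀ {F : Type} [NormedAddCommGroup F] [NormedSpace ℝ F] {f : T × ℝ → E → F},
      ContinuousOn (fun p : (T × ℝ) × E => f p.1 p.2) univ →
      Continuous (fun p : T × E => ∫ τ in a..b, f (p.1, τ) p.2) := by
    intro F _ _ f hf
    refine intervalIntegral.continuous_parametric_intervalIntegral_of_continuous' ?_ a b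
    exact (continuousOn_univ.1 hf).comp
      (by fun_prop : Continuous fun q : (T × E) × ℝ => ((q.1.1, q.2), q.1.2))
  induction k generalizing F with
  | zero => exact (hc hf).continuousOn
  | succ k ih =>
    have h0 := continuousOn_univ.1 hf.1
    have h1 := continuousOn_univ.1 hf.2.2.continuousOn
    have hd : ∀ t x, HasFDerivAt (fun x => ∫ τ in a..b, f (t, τ) x)
        (∫ τ in a..b, fderiv ℝ (f (t, τ)) x) x := by
      intro t x
      have hF : ∀ x, Continuous fun τ => f (t, τ) x := fun x =>
        h0.comp (by fun_prop : Continuous fun τ : ℝ => ((t, τ), x))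
      have hF' : Continuous fun q : ℝ × E => fderiv ℝ (f (t, q.1)) q.2 :=
        h1.comp (by fun_prop : Continuous fun q : ℝ × E => ((t, q.1), q.2))
      obtain ⟨C, hC⟩ := ((isCompact_uIcc (a := a) (b := b)).prod
        (isCompact_closedBall x 1)).exists_bound_of_continuousOn hF'.continuousOn
      refine intervalIntegral.hasFDerivAt_integral_of_dominated_of_fderiv_le
        (bound := fun _ => C) (Metric.closedBall_mem_nhds x one_pos)
        (Eventually.of_forall fun y => (hF y).aestronglyMeasurable)
        ((hF x).intervalIntegrable a b)
        (hF'.comp (Continuous.prodMk_left x)).aestronglyMeasurable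
        (Eventually.of_forall fun τ hτ y hy => hC (τ, y) ⟨uIoc_subset_uIcc hτ, hy⟩)
        intervalIntegrable_const
        (Eventually.of_forall fun τ _ y _ => (hf.2.1 ((t, τ), y) (mem_univ _)).hasFDerivAt)
    exact ⟨(hc hf.1).continuousOn, fun p _ => (hd p.1 p.2).differentiableAt,
      (ih hf.2.2).congr isOpen_univ fun p _ => (hd p.1 p.2).fderiv⟩

end ParamContDiffOn

namespace ParamSmoothOn

variable {f : T → E → F} {W : Set (T × E)}

lemma fderiv (hf : ParamSmoothOn f W) : ParamSmoothOn (fun t x => fderiv ℝ (f t) x) W :=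
  fun k => (hf (k + 1)).2.2

lemma contDiffAt (hf : ParamSmoothOn f W) (hW : IsOpen W) {t : T} {x : E} (hx : (t, x) ∈ W) :
    ContDiffAt ℝ ∞ (f t) x := by
  refine contDiffAt_infty.2 fun k => ?_
  exact ((hf k).contDiffOn_slice hW t).contDiffAt (slice_mem_nhds hW hx)

/-- Currying identifies the derivative of order `j + 1` of `f` isometrically with the derivative of
order `j` of `fderiv f`. This links the recursive definition to the iterated derivatives that define
the topology of C^∞(X). -/
lemma of_continuousOn_iteratedFDeriv
    (hd : ∀ p ∈ W, ContDiffAt ℝ ∞ (f p.1) p.2)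
    (hc : ∀ k, ContinuousOn (fun p : T × E => iteratedFDeriv ℝ k (f p.1) p.2) W) :
    ParamSmoothOn f W := by
  have h0 : ∀ {F : Type} [NormedAddCommGroup F] [NormedSpace ℝ F] {f : T → E → F},
      (∀ k, ContinuousOn (fun p : T × E => iteratedFDeriv ℝ k (f p.1) p.2) W) →
      ContinuousOn (fun p : T × E => f p.1 p.2) W := by
    intro F _ _ f hc
    have h := (continuousMultilinearCurryFin0 ℝ E F).continuous.comp_continuousOn (hc 0)
    refine h.congr fun p _ => ?_
    simp [iteratedFDeriv_zero_eq_comp]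
  intro k
  induction k generalizing F with
  | zero => exact h0 hc
  | succ k ih =>
    refine ⟨h0 hc, fun p hp => (hd p hp).differentiableAt (by simp), ih (fun p hp => ?_) fun j => ?_⟩
    · exact (hd p hp).fderiv_right (by simp)
    · have h := (continuousMultilinearCurryRightEquiv' ℝ j E F).continuous.comp_continuousOn
        (hc (j + 1))
      refine h.congr fun p _ => ?_
      simp [iteratedFDeriv_succ_eq_comp_right]

lemma continuous (hf : ParamSmoothOn f univ) : Continuous fun p : T × E => f p.1 p.2 :=
  continuousOn_univ.1 (hf 0)

end ParamSmoothOn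

end ParamContDiff

end

noncomputable section

open Set Filter MeasureTheory

/-! ### Transport of densities by shears -/

section Shear

variable {T : Type*} [TopologicalSpace T] {E : Type} [NormedAddCommGroup E] [NormedSpace ℝ E]

/-- Change the coordinate `ℓ` of `x` in the direction `e` to the value `P t x`. -/
def shear (e : E) (ℓ : E →L[ℝ] ℝ) (P : T → E → ℝ) (t : T) (x : E) : E :=
  x + (P t x - ℓ x) • e

/-- The primitive of `f t` in the direction `e` that vanishes on the kernel of `ℓ`. -/
def dirPrimitive (e : E) (ℓ : E →L[ℝ] ℝ) (f : T → E → ℝ) (t : T) (x : E) : ℝ :=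
  ∫ τ in (0 : ℝ)..1, ℓ x * f t (x - ℓ x • e + (τ * ℓ x) • e)

variable {e : E} {ℓ : E →L[ℝ] ℝ} {P f : T → E → ℝ}

omit [TopologicalSpace T] in
-- The substitution s = τ ℓ(x). The definition integrates over [0, 1] so that the limits do not
-- depend on x and differentiation under the integral applies directly.
lemma dirPrimitive_eq (t : T) (x : E) :
    dirPrimitive e ℓ f t x = ∫ s in (0 : ℝ)..ℓ x, f t (x - ℓ x • e + s • e) := by
  rw [dirPrimitive, intervalIntegral.integral_const_mul,
    ← smul_eq_mul, intervalIntegral.smul_integral_comp_mul_right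
      (fun s => f t (x - ℓ x • e + s • e))]
  simp

omit [TopologicalSpace T] in
lemma hasDerivAt_dirPrimitive (he : ℓ e = 1) {t : T} (hf : Continuous (f t)) (x : E) (σ : ℝ) :
    HasDerivAt (fun σ : ℝ => dirPrimitive e ℓ f t (x + σ • e)) (f t (x + σ • e)) σ := by
  have h1 : ∀ σ : ℝ, dirPrimitive e ℓ f t (x + σ • e)
      = ∫ s in (0 : ℝ)..(ℓ x + σ), f t (x - ℓ x • e + s • e) := fun σ => by
    have h2 : x + σ • e - (ℓ x + σ) • e = x - ℓ x • e := by rw [add_smul]; abel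
    simp [dirPrimitive_eq, he, h2]
  have hc : Continuous fun s : ℝ => f t (x - ℓ x • e + s • e) := hf.comp (by fun_prop)
  have h3 := intervalIntegral.integral_hasDerivAt_right (hc.intervalIntegrable 0 (ℓ x + σ))
    (hc.stronglyMeasurableAtFilter _ _) hc.continuousAt
  have h4 := h3.comp_const_add (ℓ x) σ
  have h5 : x - ℓ x • e + (ℓ x + σ) • e = x + σ • e := by rw [add_smul]; abel
  rw [h5] at h4
  simpa only [h1] using h4

lemma ParamSmoothOn.dirPrimitive [FiniteDimensional ℝ E] (hf : ParamSmoothOn f univ) :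
    ParamSmoothOn (dirPrimitive e ℓ f) univ := by
  intro k
  refine ParamContDiffOn.intervalIntegral (T := T)
    (f := fun (p : T × ℝ) x => ℓ x * f p.1 (x - ℓ x • e + (p.2 * ℓ x) • e)) ?_
  have hl : ParamContDiffOn k (fun (_ : T × ℝ) (x : E) => ℓ x) univ :=
    .of_contDiff ℓ.contDiff
  have he : ParamContDiffOn k (fun (_ : T × ℝ) (_ : E) => e) univ := .of_contDiff contDiff_const
  have hτ : ParamContDiffOn k (fun (p : T × ℝ) (_ : E) => p.2) univ := .of_param continuous_snd
  have hx : ParamContDiffOn k (fun (_ : T × ℝ) (x : E) => x) univ := .of_contDiff contDiff_id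
  have h1 := (hx.sub (hl.smul he isOpen_univ) isOpen_univ).add
    ((hτ.mul hl isOpen_univ).smul he isOpen_univ) isOpen_univ
  have h2 : ParamContDiffOn k (fun (p : T × ℝ) => f p.1) univ :=
    ParamContDiffOn.comp_param (θ := fun p : T × ℝ => p.1) continuous_fst (hf k)
  exact hl.mul (h2.comp h1 isOpen_univ fun _ _ => mem_univ _) isOpen_univ

section

variable (hP : ParamSmoothOn P univ) (he : ℓ e = 1)
include hP

lemma ParamSmoothOn.shear : ParamSmoothOn (shear e ℓ P) univ := by
  intro k
  have hx : ParamContDiffOn k (fun (_ : T) (x : E) => x) univ := .of_contDiff contDiff_id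
  exact hx.add (((hP k).sub (.of_contDiff ℓ.contDiff) isOpen_univ).smul
    (.of_contDiff contDiff_const) isOpen_univ) isOpen_univ

lemma hasFDerivAt_shear (t : T) (x : E) :
    HasFDerivAt (shear e ℓ P t)
      (ContinuousLinearMap.id ℝ E + (fderiv ℝ (P t) x - ℓ).smulRight e) x :=
  (hasFDerivAt_id x).add ((((hP 1).2.1 (t, x) (mem_univ _)).hasFDerivAt.sub
    ℓ.hasFDerivAt).smul_const e)

lemma hasDerivAt_line (t : T) (x : E) (σ : ℝ) :
    HasDerivAt (fun σ : ℝ => P t (x + σ • e)) (fderiv ℝ (P t) (x + σ • e) e) σ := by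
  have h1 : HasDerivAt (fun σ : ℝ => x + σ • e) e σ := by
    simpa using ((hasDerivAt_id σ).smul_const e).const_add x
  exact ((hP 1).2.1 (t, x + σ • e) (mem_univ _)).hasFDerivAt.comp_hasDerivAt σ h1

include he

/-- The derivative is the rank one perturbation id + (P' - ℓ) ⊗ e, of determinant 1 + P'(e) - ℓ(e),
and ℓ(e) = 1. -/
lemma det_fderiv_shear [FiniteDimensional ℝ E] (t : T) (x : E) :
    (fderiv ℝ (shear e ℓ P t) x).det = fderiv ℝ (P t) x e := by
  rw [(hasFDerivAt_shear hP t x).fderiv]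
  have h := LinearMap.transvection.det (fderiv ℝ (P t) x - ℓ : E →L[ℝ] ℝ).toLinearMap e
  have h2 : (1 : ℝ) + (fderiv ℝ (P t) x - ℓ : E →L[ℝ] ℝ).toLinearMap e = fderiv ℝ (P t) x e := by
    simp [he]
  rw [← h2, ← h, ContinuousLinearMap.det]
  congr 1

/-- Shears by functions with derivative bounded below are invertible, and the inverses depend
smoothly on the parameters. -/
lemma exists_inverse_shear [FiniteDimensional ℝ E]
    (hpos : ∀ t, ∃ c > 0, ∀ x, c ≤ fderiv ℝ (P t) x e) :
    ∃ N : T → E → E, ParamSmoothOn N univ ∧ (∀ t y, shear e ℓ P t (N t y) = y) ∧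
      ∀ t x, N t (shear e ℓ P t x) = x := by
  have hpos' : ∀ t x, 0 < fderiv ℝ (P t) x e := fun t x => by
    obtain ⟨c, hc, h⟩ := hpos t
    exact hc.trans_le (h x)
  have hline := hasDerivAt_line (e := e) hP
  have hmono : ∀ t x, StrictMono fun σ : ℝ => P t (x + σ • e) := fun t x =>
    strictMono_of_deriv_pos fun σ => by rw [(hline t x σ).deriv]; exact hpos' t _
  -- The lower bound `c` on the derivative makes `P t` grow at least linearly along each line, so
  -- every value is attained.
  have hsurj : ∀ t x c, ∃ σ : ℝ, P t (x + σ • e) = c := by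
    intro t x b
    obtain ⟨c, hc, h⟩ := hpos t
    have hd : ∀ σ : ℝ, HasDerivAt (fun σ : ℝ => P t (x + σ • e) - c * σ)
        (fderiv ℝ (P t) (x + σ • e) e - c) σ := fun σ => by
      simpa using (hline t x σ).fun_sub ((hasDerivAt_id σ).const_mul c)
    have hm : Monotone fun σ : ℝ => P t (x + σ • e) - c * σ :=
      monotone_of_deriv_nonneg (fun σ => (hd σ).differentiableAt) fun σ => by
        rw [(hd σ).deriv, sub_nonneg]; exact h _
    have hcont : Continuous fun σ : ℝ => P t (x + σ • e) :=
      continuous_iff_continuousAt.2 fun σ => (hline t x σ).continuousAt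
    obtain ⟨y, hy⟩ : ∃ y, y = P t x := ⟨_, rfl⟩
    refine mem_range_of_exists_le_of_exists_ge hcont ⟨-(|b - y| / c), ?_⟩ ⟨|b - y| / c, ?_⟩
    · have h1 := hm (show -(|b - y| / c) ≤ 0 by simp only [neg_nonpos]; positivity)
      have h2 : c * -(|b - y| / c) = -|b - y| := by field_simp
      simp only [h2, zero_smul, add_zero, mul_zero, ← hy] at h1
      have := neg_abs_le (b - y)
      linarith
    · have h1 := hm (show 0 ≤ |b - y| / c by positivity)
      have h2 : c * (|b - y| / c) = |b - y| := by field_simp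
      simp only [h2, zero_smul, add_zero, mul_zero, ← hy] at h1
      have := le_abs_self (b - y)
      linarith
  -- A shear moves points along `e` only, so the preimage of `y` is the point of the line through
  -- `y` where `P t` equals `ℓ y`.
  choose s hs using fun (t : T) (y : E) => hsurj t (y - ℓ y • e) (ℓ y)
  let N : T → E → E := fun t y => y - ℓ y • e + s t y • e
  have hAN : ∀ t y, shear e ℓ P t (N t y) = y := by
    intro t y
    simp only [shear, N, hs]
    simp only [map_add, map_sub, map_smul, he, smul_eq_mul, mul_one, sub_self, zero_add, sub_smul]
    abel
  have hinj : ∀ t, Function.Injective (shear e ℓ P t) := by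
    intro t x y hxy
    have h0 : P t x = P t y := by simpa [shear, he] using congrArg ℓ hxy
    have h1 : y = x + (ℓ y - ℓ x) • e := by
      simp only [shear, h0, sub_smul] at hxy ⊢
      have h2 : y = x + (P t y • e - ℓ x • e) - (P t y • e - ℓ y • e) := by rw [hxy]; abel
      nth_rewrite 1 [h2]
      abel
    have h2 : (fun σ : ℝ => P t (x + σ • e)) 0 = (fun σ : ℝ => P t (x + σ • e)) (ℓ y - ℓ x) := by
      simpa [← h1] using h0
    have h3 := (hmono t x).injective h2
    rw [h1, ← h3]; simp
  -- By monotonicity along the line, comparing `s t y` with a constant `a` amounts to comparing `ℓ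
  -- y` with the value of `P t` at the point with coordinate `a`. Strict inequality there is an open
  -- condition on (t, y).
  have hscont : Continuous fun p : T × E => s p.1 p.2 := by
    have hcP : ∀ a : ℝ, Continuous fun q : T × E =>
        P q.1 (q.2 - ℓ q.2 • e + a • e) - ℓ q.2 := fun a =>
      (hP.continuous.comp (by fun_prop :
        Continuous fun q : T × E => (q.1, q.2 - ℓ q.2 • e + a • e))).sub (by fun_prop)
    refine continuous_iff_continuousAt.2 fun p => tendsto_order.2 ⟨fun a ha => ?_, fun a ha => ?_⟩
    · have h1 := hmono p.1 (p.2 - ℓ p.2 • e) ha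
      simp only [hs] at h1
      filter_upwards [(hcP a).continuousAt.eventually_lt continuousAt_const
        (sub_neg.2 h1)] with q hq
      rw [sub_neg] at hq
      refine (hmono q.1 (q.2 - ℓ q.2 • e)).lt_iff_lt.1 ?_
      simpa only [hs] using hq
    · have h1 := hmono p.1 (p.2 - ℓ p.2 • e) ha
      simp only [hs] at h1
      filter_upwards [continuousAt_const.eventually_lt (hcP a).continuousAt
        (sub_pos.2 h1)] with q hq
      rw [sub_pos] at hq
      refine (hmono q.1 (q.2 - ℓ q.2 • e)).lt_iff_lt.1 ?_
      simpa only [hs] using hq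
  refine ⟨N, fun k => ?_, hAN, fun t x => hinj t (hAN t _)⟩
  refine (ParamSmoothOn.shear (ℓ := ℓ) (e := e) hP k).of_leftInverse (by fun_prop) hAN
    fun t x => ?_
  have hdet : (fderiv ℝ (_root_.shear e ℓ P t) x).det ≠ 0 := by
    rw [det_fderiv_shear hP he]; exact (hpos' t x).ne'
  exact ⟨ContinuousLinearMap.toContinuousLinearEquivOfDetNeZero _ hdet, by ext; simp⟩

variable [MeasurableSpace E] [BorelSpace E] [FiniteDimensional ℝ E] (μ : Measure E)
  [μ.IsAddHaarMeasure]

lemma map_shear (t : T) (hpos : ∀ x, 0 ≤ fderiv ℝ (P t) x e)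
    (hbij : Function.Bijective (shear e ℓ P t)) :
    (μ.withDensity fun x => ENNReal.ofReal (fderiv ℝ (P t) x e)).map (shear e ℓ P t) = μ := by
  have h := map_withDensity_abs_det_fderiv_eq_addHaar μ (s := univ) (f := shear e ℓ P t)
    (f' := fun x => fderiv ℝ (shear e ℓ P t) x) MeasurableSet.univ.nullMeasurableSet
    (fun x _ => (hasFDerivAt_shear hP t x).differentiableAt.hasFDerivAt.hasFDerivWithinAt)
    hbij.1.injOn
  simpa only [Measure.restrict_univ, image_univ, hbij.2.range_eq, det_fderiv_shear hP he,
    abs_of_nonneg (hpos _)] using h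

end

lemma fderiv_dirPrimitive [FiniteDimensional ℝ E] (he : ℓ e = 1) (hf : ParamSmoothOn f univ) (t : T) (x : E) :
    fderiv ℝ (dirPrimitive e ℓ f t) x e = f t x := by
  have h1 := hasDerivAt_line (e := e) (hf.dirPrimitive (ℓ := ℓ) (e := e)) t x 0
  have h2 := hasDerivAt_dirPrimitive he (f := f) (t := t)
    (hf.continuous.comp (Continuous.prodMk_right t)) x 0
  simpa using h1.unique h2

variable [MeasurableSpace E] [BorelSpace E] [FiniteDimensional ℝ E] (μ : Measure E)
  [μ.IsAddHaarMeasure]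

/-- A density can be changed by the derivative of a compactly supported function by means of a
diffeomorphism that depends smoothly on the parameters. -/
theorem exists_map_withDensity_dir (he : ℓ e = 1) {g : T → E → ℝ} (hf : ParamSmoothOn f univ)
    (hg : ParamSmoothOn g univ) (hfpos : ∀ t, ∃ c > 0, ∀ x, c ≤ f t x)
    (hgpos : ∀ t, ∃ c > 0, ∀ x, c ≤ f t x + fderiv ℝ (g t) x e)
    {K : Set E} (hK : ∀ t, ∀ x ∉ K, g t x = 0) :
    ∃ φ : T → E → E, ParamSmoothOn φ univ ∧ (∀ t, Function.Injective (φ t)) ∧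
      (∀ t, ∀ x ∉ K, φ t x = x) ∧
      ∀ t, (μ.withDensity fun x => ENNReal.ofReal (f t x)).map (φ t) =
        μ.withDensity fun x => ENNReal.ofReal (f t x + fderiv ℝ (g t) x e) := by
  set F := dirPrimitive e ℓ f with hF
  have hFs : ParamSmoothOn F univ := hf.dirPrimitive
  have hFd : ∀ t x, fderiv ℝ (F t) x e = f t x := fderiv_dirPrimitive he hf
  set F1 : T → E → ℝ := fun t x => F t x + g t x with hF1
  have hF1s : ParamSmoothOn F1 univ := fun k => (hFs k).add (hg k) isOpen_univ
  have hF1d : ∀ t x, fderiv ℝ (F1 t) x e = f t x + fderiv ℝ (g t) x e := fun t x => by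
    rw [← hFd, hF1, fderiv_fun_add ((hFs 1).2.1 (t, x) (mem_univ _))
      ((hg 1).2.1 (t, x) (mem_univ _))]
    rfl
  simp only [← hFd] at hfpos
  obtain ⟨N0, hN0, hAN0, hNA0⟩ := exists_inverse_shear hFs he hfpos
  simp only [hFd] at hfpos
  simp only [← hF1d] at hgpos
  obtain ⟨N1, hN1, hAN1, hNA1⟩ := exists_inverse_shear hF1s he hgpos
  have hcont : ∀ {f : T → E → E}, ParamSmoothOn f univ → ∀ t, Continuous (f t) := fun h t =>
    (continuousOn_univ.1 (h 0)).comp (Continuous.prodMk_right t)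
  have hA0s : ParamSmoothOn (shear e ℓ F) univ := hFs.shear
  have hA1s : ParamSmoothOn (shear e ℓ F1) univ := hF1s.shear
  -- Each shear carries its own density to `μ`, so the shear of `F` followed by the inverse of the
  -- shear of `F1` matches the densities. Where `g` vanishes the two shears agree, and the
  -- composition is the identity.
  refine ⟨fun t x => N1 t (shear e ℓ F t x), fun k => ?_, fun t => ?_, fun t x hx => ?_,
    fun t => ?_⟩
  · exact (hN1 k).comp (hA0s k) isOpen_univ fun _ _ => mem_univ _
  · exact (Function.LeftInverse.injective (hAN1 t)).comp
      (Function.LeftInverse.injective (hNA0 t))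
  · have h : shear e ℓ F t x = shear e ℓ F1 t x := by simp [shear, hF1, hK t x hx]
    simp only [h, hNA1]
  · have h0 := map_shear hFs he μ t (fun x => by
        obtain ⟨c, hc, h⟩ := hfpos t
        rw [hFd]; exact hc.le.trans (h x))
      ⟨Function.LeftInverse.injective (hNA0 t), Function.RightInverse.surjective (hAN0 t)⟩
    have h1 := map_shear hF1s he μ t (fun x => by
        obtain ⟨c, hc, h⟩ := hgpos t
        exact hc.le.trans (h x))
      ⟨Function.LeftInverse.injective (hNA1 t), Function.RightInverse.surjective (hAN1 t)⟩
    simp only [hFd] at h0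
    simp only [hF1d] at h1
    have hm : ∀ {f : T → E → E}, ParamSmoothOn f univ → Measurable (f t) :=
      fun h => (hcont h t).measurable
    change Measure.map (N1 t ∘ shear e ℓ F t) _ = _
    rw [← Measure.map_map (hm hN1) (hm hA0s), h0]
    nth_rewrite 1 [← h1]
    rw [Measure.map_map (hm hN1) (hm hA1s)]
    have h3 : N1 t ∘ shear e ℓ F1 t = id := funext (hNA1 t)
    rw [h3, Measure.map_id]

/-- A density can be changed by the divergence of a compactly supported vector field by means of a
diffeomorphism that depends smoothly on the parameters. -/
theorem exists_map_withDensity_sum {ι : Type*} (s : Finset ι) {e : ι → E} {ℓ : ι → E →L[ℝ] ℝ}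
    (he : ∀ i, ℓ i (e i) = 1) {g : ι → T → E → ℝ} (hf : ParamSmoothOn f univ)
    (hg : ∀ i, ParamSmoothOn (g i) univ)
    (hpos : ∀ u ⊆ s, ∀ t, ∃ c > 0, ∀ x, c ≤ f t x + ∑ i ∈ u, fderiv ℝ (g i t) x (e i))
    {K : Set E} (hK : ∀ i t, ∀ x ∉ K, g i t x = 0) :
    ∃ φ : T → E → E, ParamSmoothOn φ univ ∧ (∀ t, Function.Injective (φ t)) ∧
      (∀ t, ∀ x ∉ K, φ t x = x) ∧
      ∀ t, (μ.withDensity fun x => ENNReal.ofReal (f t x)).map (φ t) =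
        μ.withDensity fun x =>
          ENNReal.ofReal (f t x + ∑ i ∈ s, fderiv ℝ (g i t) x (e i)) := by
  classical
  induction s using Finset.induction_on with
  | empty =>
    refine ⟨fun _ x => x, fun k => .of_contDiff contDiff_id, fun t => Function.injective_id,
      fun _ _ _ => rfl, fun t => ?_⟩
    simp
  | insert i s hi ih =>
    -- The partial sums that occur as intermediate densities depend on the order in which the
    -- directions are added; positivity for all subsets covers every order.
    obtain ⟨φ, hφ, hinj, hid, hmap⟩ := ih fun u hu => hpos u (hu.trans (Finset.subset_insert i s))
    have hfs : ParamSmoothOn (fun t x => f t x + ∑ i ∈ s, fderiv ℝ (g i t) x (e i)) univ :=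
      fun k => (hf k).add (.sum (fun j _ => ((hg j).fderiv k).clm_comp
        (ContinuousLinearMap.apply ℝ ℝ (e j)) isOpen_univ) isOpen_univ) isOpen_univ
    have hsum : ∀ t x, f t x + ∑ i ∈ insert i s, fderiv ℝ (g i t) x (e i)
        = f t x + ∑ i ∈ s, fderiv ℝ (g i t) x (e i) + fderiv ℝ (g i t) x (e i) := fun t x => by
      rw [Finset.sum_insert hi]; ring
    obtain ⟨ψ, hψ, hinj', hid', hmap'⟩ := exists_map_withDensity_dir μ (he i) hfs (hg i)
      (hpos s (Finset.subset_insert i s)) (fun t => by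
        simpa only [hsum] using hpos _ subset_rfl t) (hK i)
    have hm : ∀ {f : T → E → E}, ParamSmoothOn f univ → ∀ t, Measurable (f t) := fun h t =>
      ((continuousOn_univ.1 (h 0)).comp (Continuous.prodMk_right t)).measurable
    refine ⟨fun t x => ψ t (φ t x), fun k => (hψ k).comp (hφ k) isOpen_univ fun _ _ => mem_univ _,
      fun t => (hinj' t).comp (hinj t), fun t x hx => by
        simp only [hid t x hx, hid' t x hx], fun t => ?_⟩
    change Measure.map (ψ t ∘ φ t) _ = _
    rw [← Measure.map_map (hm hψ t) (hm hφ t), hmap, hmap']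
    simp only [hsum]

end Shear

end

noncomputable section

open Set Filter

namespace KahlerPotentials

/-! ### Linear algebra of the top power of a 2-form, and its positivity -/

section Pairing

lemma update_pairs {V : Type*} {n : ℕ} {A : V → V → ℝ} (v : Fin n × Fin 2 → V) (p : Fin n × Fin 2) (x : V) :
    ∏ j, A (Function.update v p x (j, 0)) (Function.update v p x (j, 1)) =
      (if p.2 = 0 then A x (v (p.1, 1)) else A (v (p.1, 0)) x) *
        ∏ j ∈ Finset.univ.erase p.1, A (v (j, 0)) (v (j, 1)) := by
  rw [← Finset.mul_prod_erase _ _ (Finset.mem_univ p.1)]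
  congr 1
  · obtain ⟨i, a⟩ := p
    fin_cases a <;> simp
  · refine Finset.prod_congr rfl fun j hj => ?_
    have hj' : j ≠ p.1 := (Finset.mem_erase.1 hj).1
    have h : ∀ a, Function.update v p x (j, a) = v (j, a) := fun a =>
      Function.update_of_ne (fun h => hj' (by rw [← h])) _ _
    simp only [h]

variable {V : Type*} [AddCommGroup V] [Module ℝ V] [TopologicalSpace V] (α : V [⋀^Fin 2]→L[ℝ] ℝ)

lemma alt_swap (x y : V) : α ![x, y] = -α ![y, x] := by
  have h := α.toAlternatingMap.map_swap ![y, x] (show (0 : Fin 2) ≠ 1 by simp)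
  have h2 : ![y, x] ∘ Equiv.swap (0 : Fin 2) 1 = ![x, y] := by
    ext i; fin_cases i <;> simp
  rw [h2] at h
  exact h

lemma alt_add_left (x y z : V) : α ![x + y, z] = α ![x, z] + α ![y, z] :=
  α.vecCons_add ![z] x y

lemma alt_smul_left (c : ℝ) (x z : V) : α ![c • x, z] = c * α ![x, z] :=
  α.vecCons_smul ![z] c x

lemma alt_add_right (x y z : V) : α ![z, x + y] = α ![z, x] + α ![z, y] := by
  rw [alt_swap, alt_add_left, alt_swap α x, alt_swap α y]; ring

lemma alt_smul_right (c : ℝ) (x z : V) : α ![z, c • x] = c * α ![z, x] := by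
  rw [alt_swap, alt_smul_left, alt_swap α x]; ring

/-- An alternating form as a bilinear form. -/
def altPairing : V →ₗ[ℝ] V →ₗ[ℝ] ℝ :=
  LinearMap.mk₂ ℝ (fun x y => α ![x, y]) (fun x y z => alt_add_left α x y z)
    (fun c x z => alt_smul_left α c x z) (fun z x y => alt_add_right α x y z)
    (fun c z x => alt_smul_right α c x z)

lemma altPairing_apply (x y : V) : altPairing α x y = α ![x, y] := rfl

/-- The multilinear map whose alternatization is the exterior power. -/
def pairProduct (n : ℕ) : MultilinearMap ℝ (fun _ : Fin n × Fin 2 => V) ℝ where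
  toFun v := ∏ j, α ![v (j, 0), v (j, 1)]
  map_update_add' v p x y := by
    rename_i h
    -- The field quantifies over decidability instances, while `update_pairs` uses the standard one.
    obtain rfl : h = instDecidableEqProd := Subsingleton.elim _ _
    simp only [update_pairs (A := fun x y => α ![x, y])]
    split_ifs
    · rw [alt_add_left, add_mul]
    · rw [alt_add_right, add_mul]
  map_update_smul' v p c x := by
    rename_i h
    obtain rfl : h = instDecidableEqProd := Subsingleton.elim _ _
    simp only [update_pairs (A := fun x y => α ![x, y])]
    split_ifs
    · rw [alt_smul_left, smul_eq_mul, mul_assoc]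
    · rw [alt_smul_right, smul_eq_mul, mul_assoc]

lemma topPower_eq_alternatization (n : ℕ) (v : Fin n × Fin 2 → V) :
    topPower n α v = ((2 : ℝ) ^ n)⁻¹ * MultilinearMap.alternatization (pairProduct α n) v := by
  rw [topPower, MultilinearMap.alternatization_apply]
  congr 1
  refine Finset.sum_congr rfl fun σ _ => ?_
  rw [Units.smul_def, zsmul_eq_mul]
  rfl

/-- In top degree an alternating map is a multiple of the determinant with respect to a basis, so
the top power transforms like a volume coefficient. -/
lemma topPower_map {n : ℕ} (b : Module.Basis (Fin n × Fin 2) ℝ V) (A : V →ₗ[ℝ] V) :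
    topPower n α (A ∘ b) = LinearMap.det A * topPower n α b := by
  rw [topPower_eq_alternatization, topPower_eq_alternatization,
    AlternatingMap.eq_smul_basis_det b (MultilinearMap.alternatization (pairProduct α n))]
  simp only [AlternatingMap.smul_apply, b.det_comp, b.det_self, smul_eq_mul]
  ring

lemma topPower_comp {n : ℕ} (b : Module.Basis (Fin n × Fin 2) ℝ V) (A : V →L[ℝ] V) :
    topPower n (α.compContinuousLinearMap A) b = A.det * topPower n α b := by
  have h := topPower_map α b A.toLinearMap
  rw [ContinuousLinearMap.det, ← h, topPower, topPower]
  congr 1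
  refine Finset.sum_congr rfl fun σ _ => ?_
  congr 1
  refine Finset.prod_congr rfl fun j _ => ?_
  rw [ContinuousAlternatingMap.compContinuousLinearMap_apply]
  congr 1
  ext i; fin_cases i <;> rfl

end Pairing

section Frame

variable {n : ℕ}

/-- The standard frame as a basis. -/
def stdBasis (n : ℕ) : Module.Basis (Fin n × Fin 2) ℝ (Cn n) :=
  (Complex.basisOneI.smulTower (EuclideanSpace.basisFun (Fin n) ℂ).toBasis).reindex
    (Equiv.prodComm _ _)

lemma coe_stdBasis : ⇑(stdBasis n) = stdFrame n := by
  ext ⟨i, a⟩ j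
  fin_cases a <;> simp [stdBasis, stdFrame, Module.Basis.smulTower_apply, Complex.coe_basisOneI] 

lemma stdBasis_repr (v : Cn n) (i : Fin n) (a : Fin 2) :
    (stdBasis n).repr v (i, a) = if a = 0 then (v i).re else (v i).im := by
  rw [stdBasis, Module.Basis.repr_reindex_apply]
  change ((Complex.basisOneI.smulTower (EuclideanSpace.basisFun (Fin n) ℂ).toBasis).repr v) (a, i) = _
  rw [Module.Basis.smulTower_repr]
  fin_cases a <;> simp

/-- The real determinant of a complex linear map is |det|², the norm from ℂ to ℝ of its complex
determinant. -/
lemma det_restrictScalars_pos {V : Type*} [AddCommGroup V] [Module ℂ V] [Module ℝ V]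
    [IsScalarTower ℝ ℂ V] {A : V →ₗ[ℂ] V} (hA : LinearMap.det A ≠ 0) : 0 < LinearMap.det (A.restrictScalars ℝ) := by
  have h := LinearMap.det_restrictScalars (R := ℝ) (f := A)
  rw [Algebra.norm_complex_apply] at h
  rw [h]
  exact Complex.normSq_pos.2 hA

/-- A positive `(1,1)`-form is a sum of squares. -/
lemma exists_basis_of_positive {V : Type*} [AddCommGroup V] [Module ℂ V] [FiniteDimensional ℂ V]
    {d : ℕ} (hd : Module.finrank ℂ V = d) (B : V →ₗ[ℝ] V →ₗ[ℝ] ℝ)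
    (hJ : ∀ v w, B (Complex.I • v) (Complex.I • w) = B v w) (hswap : ∀ v w, B v w = -B w v)
    (hpos : ∀ v, v ≠ 0 → 0 < B v (Complex.I • v)) :
    ∃ z : Module.Basis (Fin d) ℂ V, ∀ v w, B v w =
      ∑ k, ((z.repr v k).re * (z.repr w k).im - (z.repr v k).im * (z.repr w k).re) := by
  subst hd
  have hII : ∀ v : V, Complex.I • Complex.I • v = -v := fun v => by
    rw [smul_smul, Complex.I_mul_I, neg_one_smul]
  have hsymm : ∀ v w, B v (Complex.I • w) = B w (Complex.I • v) := fun v w => by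
    rw [← hJ, hII, map_neg, hswap, neg_neg]
  have hI : ∀ v w, B (Complex.I • v) w = -B v (Complex.I • w) := fun v w => by
    rw [hswap, hsymm]
  have hsmul : ∀ (r : ℂ) (v : V), r • v = r.re • v + r.im • Complex.I • v := fun r v => by
    nth_rewrite 1 [← Complex.re_add_im r]
    rw [add_smul, mul_smul, Complex.coe_smul, Complex.coe_smul]
  -- The Hermitian inner product with imaginary part `B`. Expanding it in an orthonormal basis and
  -- taking imaginary parts gives the formula.
  let core : InnerProductSpace.Core ℂ V :=
    { inner := fun v w => ⟨B v (Complex.I • w), B v w⟩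
      conj_inner_symm := fun x y => by
        apply Complex.ext
        · simp [hsymm x y]
        · simp [hswap x y]
      re_inner_nonneg := fun x => by
        by_cases hx : x = 0
        · simp [hx]
        · exact (hpos x hx).le
      add_left := fun x y z => by apply Complex.ext <;> simp
      smul_left := fun x y r => by
        rw [hsmul]
        apply Complex.ext
        · simp [hI, hII]
        · simp [hI]
      definite := fun x hx => by
        by_contra h
        exact (hpos x h).ne' (congrArg Complex.re hx) }
  let _ : NormedAddCommGroup V := core.toNormedAddCommGroup
  let _ : InnerProductSpace ℂ V := InnerProductSpace.ofCore core.toCore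
  let b := stdOrthonormalBasis ℂ V
  refine ⟨b.toBasis, fun v w => ?_⟩
  have h1 : (inner ℂ v w : ℂ).im = B v w := rfl
  rw [← h1, ← b.sum_inner_mul_inner v w, Complex.im_sum]
  refine Finset.sum_congr rfl fun k _ => ?_
  rw [b.coe_toBasis_repr_apply, b.coe_toBasis_repr_apply, b.repr_apply_apply, b.repr_apply_apply,
    ← inner_conj_symm v (b k), Complex.mul_im, Complex.conj_re, Complex.conj_im]
  ring

end Frame

section PermSum

variable {n : ℕ}

/-- The sign of a permutation as a real number. -/
def sgn (σ : Equiv.Perm (Fin n × Fin 2)) : ℝ := ((Equiv.Perm.sign σ : ℤ) : ℝ)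

lemma sgn_mul_swap (σ : Equiv.Perm (Fin n × Fin 2)) {p q : Fin n × Fin 2} (h : p ≠ q) :
    sgn (σ * Equiv.swap p q) = -sgn σ := by
  simp [sgn, Equiv.Perm.sign_mul, Equiv.Perm.sign_swap h]

lemma pair_ne (i : Fin n) : ((i, 0) : Fin n × Fin 2) ≠ (i, 1) := by simp

/-- Exchanging the two slots of the pair `i` reverses the sign of the permutation and preserves `R`,
so both halves of the antisymmetrised factor contribute equally. -/
lemma sum_sgn_swap (i : Fin n) (A : Fin n × Fin 2 → Fin n × Fin 2 → ℝ)
    (R : Equiv.Perm (Fin n × Fin 2) → ℝ)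
    (hR : ∀ σ, R (σ * Equiv.swap (i, 0) (i, 1)) = R σ) :
    ∑ σ, sgn σ * ((A (σ (i, 0)) (σ (i, 1)) - A (σ (i, 1)) (σ (i, 0))) * R σ) =
      2 * ∑ σ, sgn σ * (A (σ (i, 0)) (σ (i, 1)) * R σ) := by
  have h : ∑ σ, sgn σ * (A (σ (i, 1)) (σ (i, 0)) * R σ)
      = -∑ σ, sgn σ * (A (σ (i, 0)) (σ (i, 1)) * R σ) := by
    rw [← Equiv.sum_comp (Equiv.mulRight (Equiv.swap ((i, 0) : Fin n × Fin 2) (i, 1))),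
      ← Finset.sum_neg_distrib]
    refine Finset.sum_congr rfl fun σ _ => ?_
    simp only [Equiv.coe_mulRight, sgn_mul_swap σ (pair_ne i), hR, Equiv.Perm.mul_apply,
      Equiv.swap_apply_left, Equiv.swap_apply_right]
    ring
  simp only [sub_mul, mul_sub, Finset.sum_sub_distrib, h]
  ring

lemma swap_pair_apply {i j : Fin n} (h : j ≠ i) (σ : Equiv.Perm (Fin n × Fin 2)) (a : Fin 2) :
    (σ * Equiv.swap (i, 0) (i, 1) : Equiv.Perm (Fin n × Fin 2)) (j, a) = σ (j, a) := by
  rw [Equiv.Perm.mul_apply, Equiv.swap_apply_of_ne_of_ne] <;> simp [h]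

lemma sum_sgn_prod_swap (A : Fin n × Fin 2 → Fin n × Fin 2 → ℝ) :
    ∑ σ, sgn σ * ∏ j, (A (σ (j, 0)) (σ (j, 1)) - A (σ (j, 1)) (σ (j, 0))) =
      2 ^ n * ∑ σ, sgn σ * ∏ j, A (σ (j, 0)) (σ (j, 1)) := by
  -- Only the pairs in `s` are antisymmetrised; each of them contributes a factor 2.
  have key : ∀ s : Finset (Fin n), ∑ σ, sgn σ *
      ((∏ j ∈ s, (A (σ (j, 0)) (σ (j, 1)) - A (σ (j, 1)) (σ (j, 0)))) *
        ∏ j ∈ sᶜ, A (σ (j, 0)) (σ (j, 1))) =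
      2 ^ s.card * ∑ σ, sgn σ * ∏ j, A (σ (j, 0)) (σ (j, 1)) := by
    intro s
    induction s using Finset.induction_on with
    | empty => simp
    | insert i s hi ih =>
      rw [Finset.card_insert_of_notMem hi, pow_succ', mul_assoc, ← ih]
      simp only [Finset.prod_insert hi, mul_assoc]
      rw [sum_sgn_swap i A (fun σ =>
        (∏ j ∈ s, (A (σ (j, 0)) (σ (j, 1)) - A (σ (j, 1)) (σ (j, 0)))) *
          ∏ j ∈ (insert i s)ᶜ, A (σ (j, 0)) (σ (j, 1)))]
      · congr 1
        refine Finset.sum_congr rfl fun σ _ => ?_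
        have h : sᶜ = insert i (insert i s)ᶜ := by
          ext j; by_cases h : j = i <;> simp [h, hi]
        rw [h, Finset.prod_insert (by simp)]
        ring
      · intro σ
        congr 1
        · refine Finset.prod_congr rfl fun j hj => ?_
          have hj : j ≠ i := fun h => hi (h ▸ hj)
          rw [swap_pair_apply hj, swap_pair_apply hj]
        · refine Finset.prod_congr rfl fun j hj => ?_
          have hj : j ≠ i := fun h => by simp [h] at hj
          rw [swap_pair_apply hj, swap_pair_apply hj]
  simpa using key Finset.univ

/-- Multiplying out the product amounts to choosing an index `f j` for each `j`. For a fixed `f` the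
signed sum over permutations is the Leibniz formula for the matrix with rows (f j, a). -/
lemma sum_sgn_prod_eq_sum_det (c : Fin n × Fin 2 → Fin n × Fin 2 → ℝ) :
    ∑ σ, sgn σ * ∏ j, ∑ k, c (k, 0) (σ (j, 0)) * c (k, 1) (σ (j, 1)) =
      ∑ f : Fin n → Fin n, (Matrix.of fun p q : Fin n × Fin 2 => c (f p.1, p.2) q).det := by
  simp only [Finset.prod_univ_sum, Fintype.piFinset_univ, Finset.mul_sum]
  rw [Finset.sum_comm]
  refine Finset.sum_congr rfl fun f _ => ?_
  rw [← Matrix.det_transpose, Matrix.det_apply]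
  refine Finset.sum_congr rfl fun σ _ => ?_
  rw [Units.smul_def, zsmul_eq_mul, sgn, Fintype.prod_prod_type]
  simp [Fin.prod_univ_two]

/-- An injective `f` permutes the real rows and the imaginary rows in the same way, so its sign
occurs twice and cancels. Otherwise two rows coincide and the determinant is zero. -/
lemma det_reindex_nonneg (c : Fin n × Fin 2 → Fin n × Fin 2 → ℝ) (hc : 0 < (Matrix.of c).det)
    (f : Fin n → Fin n) :
    0 ≤ (Matrix.of fun p q : Fin n × Fin 2 => c (f p.1, p.2) q).det := by
  by_cases hf : Function.Injective f
  · let π : Equiv.Perm (Fin n) := Equiv.ofBijective f (Finite.injective_iff_bijective.1 hf)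
    have h := Matrix.det_permute (Equiv.prodCongrLeft fun _ : Fin 2 => π) (Matrix.of c)
    rw [Equiv.Perm.sign_prodCongrLeft, Fin.prod_univ_two, Int.units_mul_self] at h
    have h2 : (Matrix.of fun p q : Fin n × Fin 2 => c (f p.1, p.2) q) =
      (Matrix.of c).submatrix (Equiv.prodCongrLeft fun _ : Fin 2 => π) id := rfl
    rw [h2, h]
    simpa using hc.le
  · obtain ⟨i, j, hij, hne⟩ : ∃ i j, f i = f j ∧ i ≠ j := by
      simpa [Function.Injective] using hf
    refine (Matrix.det_zero_of_row_eq (i := (i, 0)) (j := (j, 0)) (by simpa using hne) ?_).ge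
    ext q
    simp [hij]

end PermSum

section Positivity

variable {n : ℕ}

/-- The top power of a positive `(1,1)`-form is positive. -/
theorem topPower_pos (α : Cn n [⋀^Fin 2]→L[ℝ] ℝ)
    (hJ : ∀ v w, α ![Complex.I • v, Complex.I • w] = α ![v, w])
    (hpos : ∀ v, v ≠ 0 → 0 < α ![v, Complex.I • v]) : 0 < topPower n α (stdFrame n) := by
  obtain ⟨z, hz⟩ := exists_basis_of_positive (V := Cn n) (d := n) (by simp) (altPairing α) hJ
    (alt_swap α) hpos
  let Z : Cn n ≃ₗ[ℂ] Cn n := z.equivFun.trans (WithLp.linearEquiv 2 ℂ (Fin n → ℂ)).symm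
  have hZ : ∀ v k, Z v k = z.repr v k := fun v k => rfl
  let C : Fin n × Fin 2 → Fin n × Fin 2 → ℝ := fun p q =>
    LinearMap.toMatrix (stdBasis n) (stdBasis n) (Z.toLinearMap.restrictScalars ℝ) p q
  have hC : 0 < (Matrix.of C).det := by
    change 0 < (LinearMap.toMatrix (stdBasis n) (stdBasis n)
      (Z.toLinearMap.restrictScalars ℝ)).det
    rw [LinearMap.det_toMatrix]
    exact det_restrictScalars_pos (LinearEquiv.isUnit_det' Z).ne_zero
  have hCz : ∀ k a q, C (k, a) q =
      if a = 0 then (z.repr (stdFrame n q) k).re else (z.repr (stdFrame n q) k).im := by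
    intro k a q
    simp only [C, LinearMap.toMatrix_apply, stdBasis_repr, coe_stdBasis, ← hZ]
    rfl
  have hC0 : ∀ k q, C (k, 0) q = (z.repr (stdFrame n q) k).re := fun k q => by simp [hCz]
  have hC1 : ∀ k q, C (k, 1) q = (z.repr (stdFrame n q) k).im := fun k q => by simp [hCz]
  have hα : ∀ p q, α ![stdFrame n p, stdFrame n q] =
      (∑ k, C (k, 0) p * C (k, 1) q) - ∑ k, C (k, 0) q * C (k, 1) p := fun p q => by
    rw [← altPairing_apply, hz, ← Finset.sum_sub_distrib]
    refine Finset.sum_congr rfl fun k _ => ?_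
    rw [hC0, hC1, hC0, hC1]
    ring
  -- In the coordinates `z` the form is ∑ dx_k ∧ dy_k. The factor 2ⁿ from the antisymmetrisation
  -- cancels the normalisation of `topPower` and leaves a sum of nonnegative determinants, among
  -- which `f = id` gives a positive one.
  have h1 := sum_sgn_prod_swap fun p q : Fin n × Fin 2 => ∑ k, C (k, 0) p * C (k, 1) q
  rw [sum_sgn_prod_eq_sum_det C] at h1
  have h2 : topPower n α (stdFrame n) = ∑ f : Fin n → Fin n,
      (Matrix.of fun p q : Fin n × Fin 2 => C (f p.1, p.2) q).det := by
    simp only [topPower, hα]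
    change _ * ∑ σ, sgn σ * _ = _
    rw [h1]
    field_simp
  rw [h2]
  exact Finset.sum_pos' (fun f _ => det_reindex_nonneg C hC f)
    ⟨id, Finset.mem_univ _, hC⟩

end Positivity

/-! ### The difference of two top powers as a divergence -/

section Divergence

variable {n : ℕ} {V : Type} [NormedAddCommGroup V] [NormedSpace ℝ V]

/-- The cyclic permutation of the slots (i,0), (k,0), (k,1) is even and preserves `R`. The three
rotated sums are therefore equal, while by `hA` they add up to zero. With `A` the derivative of a
2-form, `hA` says that the form is closed. -/
lemma sum_sgn_cycle {i k : Fin n} (hik : k ≠ i)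
    (A : Fin n × Fin 2 → Fin n × Fin 2 → Fin n × Fin 2 → ℝ)
    (hA : ∀ p q r, A p q r + A q r p + A r p q = 0)
    (R : Equiv.Perm (Fin n × Fin 2) → ℝ)
    (hR : ∀ σ, R (σ * (Equiv.swap (i, 0) (k, 0) * Equiv.swap (k, 0) (k, 1))) = R σ) :
    ∑ σ, sgn σ * (R σ * A (σ (i, 0)) (σ (k, 0)) (σ (k, 1))) = 0 := by
  have hne : ((i, 0) : Fin n × Fin 2) ≠ (k, 0) := by simp [hik.symm]
  have hne' : ((i, 0) : Fin n × Fin 2) ≠ (k, 1) := by simp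
  set c : Equiv.Perm (Fin n × Fin 2) := Equiv.swap (i, 0) (k, 0) * Equiv.swap (k, 0) (k, 1)
    with hc
  have hs : ∀ σ : Equiv.Perm (Fin n × Fin 2), sgn (σ * c) = sgn σ := fun σ => by
    rw [hc, ← mul_assoc, sgn_mul_swap _ (pair_ne k), sgn_mul_swap _ hne, neg_neg]
  have c1 : c (i, 0) = (k, 0) := by
    simp [hc, Equiv.swap_apply_of_ne_of_ne hne hne']
  have c2 : c (k, 0) = (k, 1) := by
    simp [hc, Equiv.swap_apply_of_ne_of_ne hne'.symm (pair_ne k).symm]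
  have c3 : c (k, 1) = (i, 0) := by simp [hc]
  have shift : ∀ B : Fin n × Fin 2 → Fin n × Fin 2 → Fin n × Fin 2 → ℝ,
      ∑ σ, sgn σ * (R σ * B (σ (i, 0)) (σ (k, 0)) (σ (k, 1))) =
      ∑ σ, sgn σ * (R σ * B (σ (k, 0)) (σ (k, 1)) (σ (i, 0))) := fun B => by
    rw [← Equiv.sum_comp (Equiv.mulRight c)]
    refine Finset.sum_congr rfl fun σ _ => ?_
    simp only [Equiv.coe_mulRight, hs, hR, Equiv.Perm.mul_apply, c1, c2, c3]
  have h1 := shift A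
  have h2 := shift fun p q r => A q r p
  have h3 : ∑ σ, sgn σ * (R σ * A (σ (i, 0)) (σ (k, 0)) (σ (k, 1))) +
      ∑ σ, sgn σ * (R σ * A (σ (k, 0)) (σ (k, 1)) (σ (i, 0))) +
      ∑ σ, sgn σ * (R σ * A (σ (k, 1)) (σ (i, 0)) (σ (k, 0))) = 0 := by
    rw [← Finset.sum_add_distrib, ← Finset.sum_add_distrib]
    refine Finset.sum_eq_zero fun σ _ => ?_
    rw [← mul_add, ← mul_add, ← mul_add, ← mul_add, hA, mul_zero, mul_zero]
  linarith

/-- The coefficients of the vector field whose divergence is the exterior product of `dβ` at the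
position `i` with the closed forms `α j` at the other positions. -/
def divTerm (i : Fin n) (β : V →L[ℝ] ℝ) (α : Fin n → V [⋀^Fin 2]→L[ℝ] ℝ)
    (e : Fin n × Fin 2 → V) (p : Fin n × Fin 2) : ℝ :=
  ∑ σ : Equiv.Perm (Fin n × Fin 2), if σ (i, 0) = p then
    sgn σ * (2 * (β (e (σ (i, 1))) *
      ∏ j ∈ Finset.univ.erase i, α j ![e (σ (j, 0)), e (σ (j, 1))])) else 0

lemma extDeriv_two_apply {α : V → V [⋀^Fin 2]→L[ℝ] ℝ} {y : V} (hα : DifferentiableAt ℝ α y)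
    (a b c : V) : extDeriv α y ![a, b, c] =
      fderiv ℝ α y a ![b, c] + fderiv ℝ α y b ![c, a] + fderiv ℝ α y c ![a, b] := by
  have h : ∀ m v, fderiv ℝ (fun x => α x m) y v = fderiv ℝ α y v m := fun m v => by
    rw [fderiv_continuousAlternatingMap_apply_const_apply hα]
  rw [extDeriv_apply hα]
  simp only [h]
  have e0 : (0 : Fin 3).removeNth ![a, b, c] = ![b, c] := by
    ext i; fin_cases i <;> rfl
  have e1 : (1 : Fin 3).removeNth ![a, b, c] = ![a, c] := by
    ext i; fin_cases i <;> rfl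
  have e2 : (2 : Fin 3).removeNth ![a, b, c] = ![a, b] := by
    ext i; fin_cases i <;> rfl
  refine (Fin.sum_univ_three _).trans ?_
  rw [e0, e1, e2, alt_swap (fderiv ℝ α y b) c a]
  simp

/-- This is d(β ∧ ⋯) = dβ ∧ ⋯ for closed remaining factors. By the Leibniz rule, the terms that
differentiate some `α k` vanish by `sum_sgn_cycle`; in those that differentiate `β`, `sum_sgn_swap`
converts the factor 2 of `divTerm` into an antisymmetrisation. -/
lemma sum_fderiv_divTerm (i : Fin n) {β : V → V →L[ℝ] ℝ} {α : Fin n → V → V [⋀^Fin 2]→L[ℝ] ℝ}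
    {y : V} (hβ : DifferentiableAt ℝ β y) (hα : ∀ j, DifferentiableAt ℝ (α j) y)
    (hcl : ∀ j, extDeriv (α j) y = 0) (e : Fin n × Fin 2 → V) :
    ∑ p, fderiv ℝ (fun z => divTerm i (β z) (fun j => α j z) e p) y (e p) =
      ∑ σ, sgn σ * ((fderiv ℝ β y (e (σ (i, 0))) (e (σ (i, 1))) -
        fderiv ℝ β y (e (σ (i, 1))) (e (σ (i, 0)))) *
          ∏ j ∈ Finset.univ.erase i, α j y ![e (σ (j, 0)), e (σ (j, 1))]) := by
  have hβ' : ∀ v, HasFDerivAt (fun z => β z v) ((fderiv ℝ β y).flip v) y := fun v =>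
    (ContinuousLinearMap.apply ℝ ℝ v).hasFDerivAt.comp y hβ.hasFDerivAt
  have hα' : ∀ j m, HasFDerivAt (fun z => α j z m)
      (fderiv ℝ (fun z => α j z m) y) y := fun j m => by
    have : DifferentiableAt ℝ (fun z => α j z m) y := by
      have := hα j
      fun_prop
    exact this.hasFDerivAt
  have hα2 : ∀ j m v, fderiv ℝ (fun z => α j z m) y v = fderiv ℝ (α j) y v m := fun j m v => by
    rw [fderiv_continuousAlternatingMap_apply_const_apply (hα j)]
  have hterm : ∀ σ : Equiv.Perm (Fin n × Fin 2), ∃ L : V →L[ℝ] ℝ,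
      HasFDerivAt (fun z => sgn σ * (2 * (β z (e (σ (i, 1))) *
        ∏ j ∈ Finset.univ.erase i, α j z ![e (σ (j, 0)), e (σ (j, 1))]))) L y ∧
      ∀ v, L v = 2 * (sgn σ * (fderiv ℝ β y v (e (σ (i, 1))) *
          ∏ j ∈ Finset.univ.erase i, α j y ![e (σ (j, 0)), e (σ (j, 1))])) +
        2 * ∑ k ∈ Finset.univ.erase i, sgn σ * ((β y (e (σ (i, 1))) *
          ∏ j ∈ (Finset.univ.erase i).erase k, α j y ![e (σ (j, 0)), e (σ (j, 1))]) *
            fderiv ℝ (α k) y v ![e (σ (k, 0)), e (σ (k, 1))]) := by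
    intro σ
    refine ⟨_, (((hβ' (e (σ (i, 1)))).mul (HasFDerivAt.finsetProd (u := Finset.univ.erase i)
      fun j _ => hα' j ![e (σ (j, 0)), e (σ (j, 1))])).const_mul 2).const_mul (sgn σ), fun v => ?_⟩
    simp only [smul_apply, add_apply,
      sum_apply, hα2, ContinuousLinearMap.flip_apply, smul_eq_mul,
      Finset.mul_sum, mul_add]
    rw [add_comm]
    congr 1
    · ring
    · exact Finset.sum_congr rfl fun k _ => by ring
  choose L hL hLv using hterm
  have hdiv : ∀ p, HasFDerivAt (fun z => divTerm i (β z) (fun j => α j z) e p)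
      (∑ σ, if σ (i, 0) = p then L σ else 0) y := fun p => by
    refine HasFDerivAt.fun_sum (u := Finset.univ) fun σ _ => ?_
    split_ifs
    · exact hL σ
    · exact hasFDerivAt_const _ _
  have h1 : ∑ p, fderiv ℝ (fun z => divTerm i (β z) (fun j => α j z) e p) y (e p) =
      ∑ σ, L σ (e (σ (i, 0))) := by
    simp only [fun p => (hdiv p).fderiv, sum_apply]
    rw [Finset.sum_comm]
    refine Finset.sum_congr rfl fun σ _ => ?_
    -- Each permutation enters one component only, so the divergence differentiates its term in the
    -- direction placed in slot (i,0).
    rw [Finset.sum_eq_single (σ (i, 0))]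
    · simp
    · intro p _ hp
      simp [hp.symm]
    · simp
  have h2 : ∀ k ∈ Finset.univ.erase i, ∑ σ, sgn σ * ((β y (e (σ (i, 1))) *
      ∏ j ∈ (Finset.univ.erase i).erase k, α j y ![e (σ (j, 0)), e (σ (j, 1))]) *
        fderiv ℝ (α k) y (e (σ (i, 0))) ![e (σ (k, 0)), e (σ (k, 1))]) = 0 := by
    intro k hk
    have hk : k ≠ i := (Finset.mem_erase.1 hk).1
    refine sum_sgn_cycle hk (fun p q r => fderiv ℝ (α k) y (e p) ![e q, e r]) (fun p q r => ?_)
      (fun σ => β y (e (σ (i, 1))) * ∏ j ∈ (Finset.univ.erase i).erase k,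
        α j y ![e (σ (j, 0)), e (σ (j, 1))]) fun σ => ?_
    · rw [← extDeriv_two_apply (hα k), hcl k]; rfl
    · have hfix : ∀ p : Fin n × Fin 2, p ≠ (i, 0) → p.1 ≠ k →
          (σ * (Equiv.swap (i, 0) (k, 0) * Equiv.swap (k, 0) (k, 1)) :
            Equiv.Perm (Fin n × Fin 2)) p = σ p := by
        intro p hp hpk
        have hk0 : p ≠ (k, 0) := fun h => hpk (by rw [h])
        have hk1 : p ≠ (k, 1) := fun h => hpk (by rw [h])
        rw [Equiv.Perm.mul_apply, Equiv.Perm.mul_apply, Equiv.swap_apply_of_ne_of_ne hk0 hk1,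
          Equiv.swap_apply_of_ne_of_ne hp hk0]
      rw [hfix (i, 1) (by simp) (by simpa using hk.symm)]
      congr 1
      refine Finset.prod_congr rfl fun j hj => ?_
      have hjk : j ≠ k := (Finset.mem_erase.1 hj).1
      have hji : j ≠ i := (Finset.mem_erase.1 (Finset.mem_erase.1 hj).2).1
      rw [hfix (j, 0) (by simp [hji]) hjk, hfix (j, 1) (by simp) hjk]
  rw [h1]
  simp only [hLv]
  rw [Finset.sum_add_distrib, ← Finset.mul_sum, ← Finset.mul_sum, Finset.sum_comm,
    Finset.sum_eq_zero h2, mul_zero, add_zero]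
  symm
  refine sum_sgn_swap i (fun p q => fderiv ℝ β y (e p) (e q)) (fun σ =>
    ∏ j ∈ Finset.univ.erase i, α j y ![e (σ (j, 0)), e (σ (j, 1))]) fun σ => ?_
  refine Finset.prod_congr rfl fun j hj => ?_
  have hj : j ≠ i := (Finset.mem_erase.1 hj).1
  rw [swap_pair_apply hj, swap_pair_apply hj]

/-- The vector field whose divergence is the difference of the top powers of `θ'` and `θ`, where
`θ' - θ` is the exterior derivative of `β`. -/
def divPotential (n : ℕ) (β : V →L[ℝ] ℝ) (θ θ' : V [⋀^Fin 2]→L[ℝ] ℝ)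
    (e : Fin n × Fin 2 → V) (p : Fin n × Fin 2) : ℝ :=
  ((2 : ℝ) ^ n)⁻¹ * ∑ i, divTerm i β (fun j => if j < i then θ' else θ) e p

lemma divTerm_differentiableAt (i : Fin n) {β : V → V →L[ℝ] ℝ}
    {α : Fin n → V → V [⋀^Fin 2]→L[ℝ] ℝ} {y : V} (hβ : DifferentiableAt ℝ β y)
    (hα : ∀ j, DifferentiableAt ℝ (α j) y) (e : Fin n × Fin 2 → V) (p : Fin n × Fin 2) :
    DifferentiableAt ℝ (fun z => divTerm i (β z) (fun j => α j z) e p) y := by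
  refine DifferentiableAt.fun_sum fun σ _ => ?_
  split_ifs
  · have h : ∀ j, DifferentiableAt ℝ (fun z => α j z ![e (σ (j, 0)), e (σ (j, 1))]) y :=
      fun j => by
        have := hα j
        fun_prop
    exact ((DifferentiableAt.mul (by fun_prop) (HasFDerivAt.finsetProd fun j _ =>
      (h j).hasFDerivAt).differentiableAt).const_mul 2).const_mul _
  · fun_prop

/-- Since θ' = θ + dβ, telescoping gives θ'ⁿ - θⁿ as the sum of the products with `θ'` at the
positions before i, dβ at i and `θ` after i. All factors but dβ are closed, so each product is the
divergence computed in `sum_fderiv_divTerm`. -/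
theorem topPower_sub_eq_divergence {β : V → V →L[ℝ] ℝ} {θ θ' : V → V [⋀^Fin 2]→L[ℝ] ℝ}
    {y : V} (hβ : DifferentiableAt ℝ β y) (hθ : DifferentiableAt ℝ θ y)
    (hθ' : DifferentiableAt ℝ θ' y) (hcl : extDeriv θ y = 0) (hcl' : extDeriv θ' y = 0)
    (hd : ∀ a b, θ' y ![a, b] = θ y ![a, b] + (fderiv ℝ β y a b - fderiv ℝ β y b a))
    (e : Fin n × Fin 2 → V) :
    topPower n (θ' y) e = topPower n (θ y) e +
      ∑ p, fderiv ℝ (fun z => divPotential n (β z) (θ z) (θ' z) e p) y (e p) := by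
  have hα : ∀ i j : Fin n, DifferentiableAt ℝ (fun z => if j < i then θ' z else θ z) y :=
    fun i j => by split_ifs <;> assumption
  have hαc : ∀ i j : Fin n, extDeriv (fun z => if j < i then θ' z else θ z) y = 0 :=
    fun i j => by split_ifs <;> assumption
  have h1 : ∀ p, fderiv ℝ (fun z => divPotential n (β z) (θ z) (θ' z) e p) y (e p) =
      ((2 : ℝ) ^ n)⁻¹ * ∑ i, fderiv ℝ
        (fun z => divTerm i (β z) (fun j => if j < i then θ' z else θ z) e p) y (e p) := by
    intro p
    have h := (HasFDerivAt.fun_sum (u := Finset.univ) fun i _ =>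
      (divTerm_differentiableAt (n := n) i hβ (hα i) e p).hasFDerivAt).const_mul
        ((2 : ℝ) ^ n)⁻¹
    simp only [divPotential]
    rw [h.fderiv]
    simp
  simp only [h1]
  rw [← Finset.mul_sum, Finset.sum_comm]
  simp only [fun i => sum_fderiv_divTerm i hβ (hα i) (hαc i) e]
  rw [topPower, topPower, ← mul_add, Finset.sum_comm, ← Finset.sum_add_distrib]
  congr 1
  refine Finset.sum_congr rfl fun σ _ => ?_
  rw [← Finset.mul_sum, sgn, ← mul_add]
  congr 1
  simp only [hd]
  -- The telescoping expansion; its order of factors is the one built into `divPotential`.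
  rw [Finset.prod_add_ordered]
  congr 1
  refine Finset.sum_congr rfl fun i _ => ?_
  rw [mul_assoc]
  congr 1
  simp only [← hd]
  have hs : Finset.univ.erase i =
      (Finset.univ.filter (· < i)) ∪ Finset.univ.filter (i < ·) := by
    ext j; simp
  rw [hs, Finset.prod_union]
  · congr 1
    · refine Finset.prod_congr rfl fun j hj => ?_
      rw [if_pos (Finset.mem_filter.1 hj).2]
    · refine Finset.prod_congr rfl fun j hj => ?_
      rw [if_neg (Finset.mem_filter.1 hj).2.asymm]
  · rw [Finset.disjoint_left]
    intro j hj hj'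
    exact (Finset.mem_filter.1 hj).2.asymm (Finset.mem_filter.1 hj').2

end Divergence

end KahlerPotentials

end

noncomputable section

open Set Filter

namespace KahlerPotentials

/-! ### Holomorphic transition maps and forms in charts -/

section Charts

lemma transition_mem_nhds {X E : Type*} [TopologicalSpace X] [TopologicalSpace E]
    {e c : OpenPartialHomeomorph X E} {y : E} (hy : y ∈ e.target) (hyc : e.symm y ∈ c.source) :
    (e.symm ≫ₕ c).source ∈ 𝓝 y :=
  (e.symm ≫ₕ c).open_source.mem_nhds (by simp [hy, hyc])

lemma fderiv_transition_self {X E : Type*} [TopologicalSpace X] [NormedAddCommGroup E]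
    [NormedSpace ℝ E] {e : OpenPartialHomeomorph X E} {y : E} (hy : y ∈ e.target) :
    fderiv ℝ (e ∘ e.symm) y = ContinuousLinearMap.id ℝ E := by
  have h : (e ∘ e.symm : E → E) =ᶠ[𝓝 y] id := by
    filter_upwards [e.open_target.mem_nhds hy] with z hz using e.right_inv hz
  rw [h.fderiv_eq, fderiv_id]

variable {n : ℕ} {X : Type*} [TopologicalSpace X] [ChartedSpace (Cn n) X]

lemma contDiffOn_transition_complex [IsManifold 𝓘(ℂ, Cn n) ∞ X]
    {e c : OpenPartialHomeomorph X (Cn n)} (he : e ∈ atlas (Cn n) X) (hc : c ∈ atlas (Cn n) X) :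
    ContDiffOn ℂ ∞ (c ∘ e.symm) (e.symm ≫ₕ c).source := by
  have := HasGroupoid.compatible (G := contDiffGroupoid ∞ 𝓘(ℂ, Cn n)) he hc
  rw [contDiffGroupoid, mem_groupoid_of_pregroupoid] at this
  simpa [contDiffPregroupoid] using this.1

/-- The real manifold underlying a complex manifold. -/
instance isManifold_real [IsManifold 𝓘(ℂ, Cn n) ∞ X] : IsManifold 𝓘(ℝ, Cn n) ∞ X :=
  isManifold_of_contDiffOn _ _ _ fun e c he hc => by
    simpa using (contDiffOn_transition_complex he hc).restrict_scalars ℝ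

variable [IsManifold 𝓘(ℂ, Cn n) ∞ X] {e c : OpenPartialHomeomorph X (Cn n)}
  (he : e ∈ atlas (Cn n) X) (hc : c ∈ atlas (Cn n) X) {y : Cn n}

include he hc

lemma contDiffAt_transition_complex (hy : y ∈ e.target) (hyc : e.symm y ∈ c.source) :
    ContDiffAt ℂ ∞ (c ∘ e.symm) y :=
  (contDiffOn_transition_complex he hc).contDiffAt (transition_mem_nhds hy hyc)

lemma contDiffAt_transition (hy : y ∈ e.target) (hyc : e.symm y ∈ c.source) :
    ContDiffAt ℝ ∞ (c ∘ e.symm) y :=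
  (contDiffAt_transition_complex he hc hy hyc).restrict_scalars ℝ

lemma fderiv_transition_smul (hy : y ∈ e.target) (hyc : e.symm y ∈ c.source) (a : ℂ) (v : Cn n) :
    fderiv ℝ (c ∘ e.symm) y (a • v) = a • fderiv ℝ (c ∘ e.symm) y v := by
  rw [((contDiffAt_transition_complex he hc hy hyc).differentiableAt
    (by simp)).fderiv_restrictScalars ℝ]
  simp

/-- Chain rule for the composition of a function in a chart with a transition map. -/
lemma fderiv_comp_transition {F : Type*} [NormedAddCommGroup F] [NormedSpace ℝ F] {f : X → F}
    (hy : y ∈ e.target) (hyc : e.symm y ∈ c.source)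
    (hf : DifferentiableAt ℝ (f ∘ c.symm) (c (e.symm y))) :
    fderiv ℝ (f ∘ e.symm) y =
      (fderiv ℝ (f ∘ c.symm) (c (e.symm y))).comp (fderiv ℝ (c ∘ e.symm) y) := by
  have h := fderiv_comp y (g := f ∘ c.symm) (f := c ∘ e.symm) hf
    ((contDiffAt_transition he hc hy hyc).differentiableAt (by simp))
  refine Eq.trans ?_ h
  refine Filter.EventuallyEq.fderiv_eq ?_
  filter_upwards [transition_mem_nhds hy hyc] with z hz
  have hz' : e.symm z ∈ c.source := by simpa using hz.2
  simp [c.left_inv hz']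

lemma fderiv_transition_symm_comp (hy : y ∈ e.target) (hyc : e.symm y ∈ c.source) :
    (fderiv ℝ (e ∘ c.symm) (c (e.symm y))).comp (fderiv ℝ (c ∘ e.symm) y) =
      ContinuousLinearMap.id ℝ (Cn n) := by
  have h1 : e.symm y ∈ e.source := e.map_target hy
  rw [← fderiv_comp_transition he hc hy hyc, fderiv_transition_self hy]
  refine (contDiffAt_transition hc he (c.map_source hyc) ?_).differentiableAt (by simp)
  rwa [c.left_inv hyc]

lemma fderiv_transition_injective (hy : y ∈ e.target) (hyc : e.symm y ∈ c.source) {v : Cn n}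
    (hv : v ≠ 0) : fderiv ℝ (c ∘ e.symm) y v ≠ 0 := fun h => hv <| by
  simpa [h] using (congrArg (fun L => L v) (fderiv_transition_symm_comp he hc hy hyc)).symm

/-- The derivative is complex linear and invertible. Complex charts are thus consistently oriented,
and the absolute value in the change of variables formula disappears. -/
lemma det_fderiv_transition_pos (hy : y ∈ e.target) (hyc : e.symm y ∈ c.source) :
    0 < (fderiv ℝ (c ∘ e.symm) y).det := by
  have h1 := ((contDiffAt_transition_complex he hc hy hyc).differentiableAt
    (by simp)).fderiv_restrictScalars ℝ
  have h2 : ((fderiv ℝ (e ∘ c.symm) (c (e.symm y))).comp (fderiv ℝ (c ∘ e.symm) y)).det = 1 := by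
    rw [fderiv_transition_symm_comp he hc hy hyc, ContinuousLinearMap.det]
    exact LinearMap.det_id
  have h3 : (fderiv ℝ (c ∘ e.symm) y).det ≠ 0 := fun h => by
    have h4 : ((fderiv ℝ (e ∘ c.symm) (c (e.symm y))).comp (fderiv ℝ (c ∘ e.symm) y)).det =
        (fderiv ℝ (e ∘ c.symm) (c (e.symm y))).det * (fderiv ℝ (c ∘ e.symm) y).det :=
      LinearMap.det_comp _ _
    rw [h4, h, mul_zero] at h2
    exact zero_ne_one h2
  have h5 : (fderiv ℝ (c ∘ e.symm) y).det =
      LinearMap.det ((fderiv ℂ (c ∘ e.symm) y).toLinearMap.restrictScalars ℝ) := by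
    rw [h1]; rfl
  rw [h5] at h3 ⊢
  refine det_restrictScalars_pos fun h => h3 ?_
  rw [LinearMap.det_restrictScalars, h, Algebra.norm_complex_apply, Complex.normSq_zero]

omit hc in
-- The tangent space at a point is identified with ℂⁿ through the preferred chart there, so the
-- manifold derivative of `e.symm` is that of a transition map.
lemma mfderiv_symm (hy : y ∈ e.target) :
    mfderiv 𝓘(ℝ, Cn n) 𝓘(ℝ, Cn n) e.symm y =
      fderiv ℝ (chartAt (Cn n) (e.symm y) ∘ e.symm) y := by
  refine (mdifferentiableAt_atlas_symm he hy).mfderiv.trans ?_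
  simp only [writtenInExtChartAt, mfld_simps, fderivWithin_univ]
  rfl

omit he hc in
lemma mfderiv_chartAt (x : X) :
    mfderiv 𝓘(ℝ, Cn n) 𝓘(ℝ, Cn n) (chartAt (Cn n) x) x =
      ContinuousLinearMap.id ℝ (Cn n) := by
  have hx := mem_chart_source (Cn n) x
  have ha := chart_mem_atlas (Cn n) x
  refine (mdifferentiableAt_atlas ha hx).mfderiv.trans ?_
  rw [← fderiv_transition_self ((chartAt (Cn n) x).map_source hx)]
  simp only [writtenInExtChartAt, mfld_simps, fderivWithin_univ]
  rfl

omit hc in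
lemma inChart_eq {k : ℕ} (α : DiffForm n X k) (hy : y ∈ e.target) :
    inChart e α y = ContinuousAlternatingMap.compContinuousLinearMap
      (show (Cn n) [⋀^Fin k]→L[ℝ] ℝ from α (e.symm y))
      (fderiv ℝ (chartAt (Cn n) (e.symm y) ∘ e.symm) y) := by
  rw [← mfderiv_symm he hy]
  rfl

lemma inChart_transition {k : ℕ} (α : DiffForm n X k) (hy : y ∈ e.target)
    (hyc : e.symm y ∈ c.source) :
    inChart e α y = (inChart c α (c (e.symm y))).compContinuousLinearMap
      (fderiv ℝ (c ∘ e.symm) y) := by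
  rw [inChart_eq he α hy, inChart_eq hc α (c.map_source hyc), c.left_inv hyc,
    fderiv_comp_transition he hc hy hyc]
  · rfl
  · refine (contDiffAt_transition hc (chart_mem_atlas (Cn n) _) (c.map_source hyc)
      ?_).differentiableAt (by simp)
    rw [c.left_inv hyc]
    exact mem_chart_source _ _

omit hc in
/-- The exterior derivative can be computed in any chart. -/
lemma inChart_extD {k : ℕ} {α : DiffForm n X k}
    (hα : ∀ c ∈ atlas (Cn n) X, ∀ y ∈ c.target, DifferentiableAt ℝ (inChart c α) y)
    (hy : y ∈ e.target) : inChart e (extD α) y = extDeriv (inChart e α) y := by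
  set x := e.symm y with hx
  have hc := chart_mem_atlas (Cn n) x
  have hyc : e.symm y ∈ (chartAt (Cn n) x).source := mem_chart_source _ x
  -- The chart at `x` is kept fixed while z varies near y. The expression of `α` in `e` is then a
  -- pullback by one smooth map, with which the exterior derivative commutes.
  have h1 : inChart e α =ᶠ[𝓝 y] fun z =>
      (inChart (chartAt (Cn n) x) α ((chartAt (Cn n) x ∘ e.symm) z)).compContinuousLinearMap
        (fderiv ℝ (chartAt (Cn n) x ∘ e.symm) z) := by
    filter_upwards [transition_mem_nhds hy hyc] with z hz
    exact inChart_transition he hc α (by simpa using hz.1) (by simpa using hz.2)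
  rw [h1.extDeriv_eq]
  refine Eq.trans ?_ (extDeriv_pullback (f := chartAt (Cn n) x ∘ e.symm) (r := ∞)
    (hα _ hc _ ((chartAt (Cn n) x).map_source hyc))
    (contDiffAt_transition he hc hy hyc) (by simpa [minSmoothness_of_isRCLikeNormedField] using ENat.LEInfty.out)).symm
  rw [inChart_eq he _ hy, ← hx]
  have h2 : (show (Cn n) [⋀^Fin (k + 1)]→L[ℝ] ℝ from extD α x) =
      extDeriv (inChart (chartAt (Cn n) x) α) (chartAt (Cn n) x x) := by
    change ContinuousAlternatingMap.compContinuousLinearMap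
      (extDeriv (inChart (chartAt (Cn n) x) α) (chartAt (Cn n) x x))
      (mfderiv 𝓘(ℝ, Cn n) 𝓘(ℝ, Cn n) (chartAt (Cn n) x) x : Cn n →L[ℝ] Cn n) = _
    rw [mfderiv_chartAt]
    rfl
  rw [h2]
  rfl

end Charts

end KahlerPotentials

end

noncomputable section

open Set Filter

namespace KahlerPotentials

/-! ### The forms d^c u, dd^c u and ω_u in charts -/

section FormsInCharts

variable {n : ℕ}

/-- Multiplication by `i` as a real linear map. -/
def mulI (n : ℕ) : Cn n →L[ℝ] Cn n :=
  ((Complex.I • ContinuousLinearMap.id ℂ (Cn n)).restrictScalars ℝ : Cn n →L[ℝ] Cn n)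

/-- The linear map that takes `df` to `d^c f`. -/
def dcLin (n : ℕ) : (Cn n →L[ℝ] ℝ) →L[ℝ] Cn n →L[ℝ] ℝ :=
  (-(1 / 2) : ℝ) • (ContinuousLinearMap.compL ℝ (Cn n) (Cn n) ℝ).flip (mulI n)

/-- The linear map that takes the derivative of a 1-form to its exterior derivative. -/
def ddLin (n : ℕ) : (Cn n →L[ℝ] Cn n →L[ℝ] ℝ) →L[ℝ] Cn n [⋀^Fin 2]→L[ℝ] ℝ :=
  (ContinuousAlternatingMap.alternatizeUncurryFinCLM ℝ (Cn n) ℝ).comp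
    (ContinuousLinearMap.compL ℝ (Cn n) (Cn n →L[ℝ] ℝ) (Cn n [⋀^Fin 1]→L[ℝ] ℝ)
      (ContinuousAlternatingMap.ofSubsingletonLIE (𝕜 := ℝ) (E := Cn n) (F := ℝ)
        (0 : Fin 1)).toContinuousLinearEquiv.toContinuousLinearMap)

lemma ddLin_apply (B : Cn n →L[ℝ] Cn n →L[ℝ] ℝ) (a b : Cn n) :
    ddLin n B ![a, b] = B a b - B b a := by
  change ContinuousAlternatingMap.alternatizeUncurryFin _ ![a, b] = _
  rw [ContinuousAlternatingMap.alternatizeUncurryFin_apply]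
  refine (Fin.sum_univ_two _).trans ?_
  simp [sub_eq_add_neg, Fin.removeNth, Fin.succAbove]

lemma extDeriv_ofSubsingleton {β : Cn n → Cn n →L[ℝ] ℝ} {y : Cn n}
    (hβ : DifferentiableAt ℝ β y) :
    extDeriv (fun z => ContinuousAlternatingMap.ofSubsingleton ℝ (Cn n) ℝ (0 : Fin 1) (β z)) y =
      ddLin n (fderiv ℝ β y) := by
  have h : HasFDerivAt (fun z => ContinuousAlternatingMap.ofSubsingletonLIE (𝕜 := ℝ) (0 : Fin 1)
      (β z)) _ y :=
    (ContinuousAlternatingMap.ofSubsingletonLIE (𝕜 := ℝ) (E := Cn n) (F := ℝ)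
        (0 : Fin 1)).toContinuousLinearEquiv.toContinuousLinearMap.hasFDerivAt.comp y
      hβ.hasFDerivAt
  have h2 := h.fderiv
  rw [extDeriv]
  change ContinuousAlternatingMap.alternatizeUncurryFin (fderiv ℝ
    (fun z => ContinuousAlternatingMap.ofSubsingletonLIE (𝕜 := ℝ) (0 : Fin 1) (β z)) y) = _
  rw [h2]
  rfl

variable {X : Type*} [TopologicalSpace X] [ChartedSpace (Cn n) X] [IsManifold 𝓘(ℂ, Cn n) ∞ X]
  {e : OpenPartialHomeomorph X (Cn n)} (he : e ∈ atlas (Cn n) X) {y : Cn n}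

include he

lemma contDiffOn_chart (u : SmoothFun n X) : ContDiffOn ℝ ∞ (u ∘ e.symm) e.target := by
  rw [← contMDiffOn_iff_contDiffOn]
  exact u.contMDiff.comp_contMDiffOn (contMDiffOn_symm_of_mem_maximalAtlas
    (IsManifold.subset_maximalAtlas he))

lemma contDiffAt_chart (u : SmoothFun n X) (hy : y ∈ e.target) :
    ContDiffAt ℝ ∞ (u ∘ e.symm) y :=
  (contDiffOn_chart he u).contDiffAt (e.open_target.mem_nhds hy)

lemma contDiffAt_dcLin (u : SmoothFun n X) (hy : y ∈ e.target) :
    ContDiffAt ℝ ∞ (fun z => dcLin n (fderiv ℝ (u ∘ e.symm) z)) y :=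
  (dcLin n).contDiff.contDiffAt.comp y ((contDiffAt_chart he u hy).fderiv_right (by simp))

/-- The derivatives of transition maps commute with multiplication by i, so d^c has the same
coordinate formula in every chart. -/
lemma inChart_dc (u : SmoothFun n X) (hy : y ∈ e.target) :
    inChart e (dc u) y = ContinuousAlternatingMap.ofSubsingleton ℝ (Cn n) ℝ (0 : Fin 1)
      (dcLin n (fderiv ℝ (u ∘ e.symm) y)) := by
  set x := e.symm y with hx
  have hc := chart_mem_atlas (Cn n) x
  have hyc : e.symm y ∈ (chartAt (Cn n) x).source := mem_chart_source _ x
  have hyt := (chartAt (Cn n) x).map_source hyc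
  rw [inChart_eq he _ hy, fderiv_comp_transition he hc hy hyc
    ((contDiffAt_chart hc u hyt).differentiableAt (by simp))]
  have h1 : (show Cn n →L[ℝ] ℝ from mfderiv 𝓘(ℝ, Cn n) 𝓘(ℝ, ℝ) u x) =
      fderiv ℝ (u ∘ (chartAt (Cn n) x).symm) (chartAt (Cn n) x x) := by
    refine ((u.contMDiff x).mdifferentiableAt (by simp)).mfderiv.trans ?_
    simp only [writtenInExtChartAt, mfld_simps, fderivWithin_univ]
    rfl
  ext v
  change (-(1 / 2) : ℝ) * (show Cn n →L[ℝ] ℝ from mfderiv 𝓘(ℝ, Cn n) 𝓘(ℝ, ℝ) u x)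
    (Complex.I • fderiv ℝ (chartAt (Cn n) x ∘ e.symm) y (v 0)) = _
  rw [h1, ← fderiv_transition_smul he hc hy hyc]
  rfl

lemma contDiffAt_inChart_dc (u : SmoothFun n X) (hy : y ∈ e.target) :
    ContDiffAt ℝ ∞ (inChart e (dc u)) y := by
  have h : inChart e (dc u) =ᶠ[𝓝 y] fun z =>
      (ContinuousAlternatingMap.ofSubsingletonLIE (𝕜 := ℝ) (E := Cn n) (F := ℝ) (0 : Fin 1))
        (dcLin n (fderiv ℝ (u ∘ e.symm) z)) := by
    filter_upwards [e.open_target.mem_nhds hy] with z hz using inChart_dc he u hz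
  exact ((LinearIsometryEquiv.contDiff _).contDiffAt.comp y
    (contDiffAt_dcLin he u hy)).congr_of_eventuallyEq h

lemma inChart_ddc_eq_extDeriv (u : SmoothFun n X) (hy : y ∈ e.target) :
    inChart e (ddc u) y = extDeriv (inChart e (dc u)) y :=
  inChart_extD he (fun _ hc _ hz =>
    (contDiffAt_inChart_dc hc u hz).differentiableAt (by simp)) hy

lemma inChart_ddc (u : SmoothFun n X) (hy : y ∈ e.target) :
    inChart e (ddc u) y =
      ddLin n (fderiv ℝ (fun z => dcLin n (fderiv ℝ (u ∘ e.symm) z)) y) := by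
  rw [inChart_ddc_eq_extDeriv he u hy, ← extDeriv_ofSubsingleton
    ((contDiffAt_dcLin he u hy).differentiableAt (by simp))]
  refine Filter.EventuallyEq.extDeriv_eq ?_
  filter_upwards [e.open_target.mem_nhds hy] with z hz using inChart_dc he u hz

variable (Ω : KahlerForm n X) (u : SmoothFun n X)

lemma inChart_twist (hy : y ∈ e.target) : inChart e (Ω.twist u) y = inChart e Ω.form y +
    ddLin n (fderiv ℝ (fun z => dcLin n (fderiv ℝ (u ∘ e.symm) z)) y) := by
  rw [← inChart_ddc he u hy]; rfl

omit [IsManifold 𝓘(ℂ, Cn n) ∞ X] in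
lemma contDiffAt_inChart_form (hy : y ∈ e.target) : ContDiffAt ℝ ∞ (inChart e Ω.form) y :=
  (Ω.smooth e he).contDiffAt (e.open_target.mem_nhds hy)

lemma contDiffAt_inChart_twist (hy : y ∈ e.target) :
    ContDiffAt ℝ ∞ (inChart e (Ω.twist u)) y := by
  have h : inChart e (Ω.twist u) =ᶠ[𝓝 y] fun y => inChart e Ω.form y +
      ddLin n (fderiv ℝ (fun z => dcLin n (fderiv ℝ (u ∘ e.symm) z)) y) := by
    filter_upwards [e.open_target.mem_nhds hy] with z hz using inChart_twist he Ω u hz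
  refine ContDiffAt.congr_of_eventuallyEq ((contDiffAt_inChart_form he Ω hy).add ?_) h
  exact (ddLin n).contDiff.contDiffAt.comp y
    ((contDiffAt_dcLin he u hy).fderiv_right (m := ∞) (by simp))

/-- The form ω is closed by assumption, and dd^c u is closed because d² = 0. -/
lemma extDeriv_inChart_twist (hy : y ∈ e.target) :
    extDeriv (inChart e (Ω.twist u)) y = 0 := by
  have h : inChart e (Ω.twist u) =ᶠ[𝓝 y]
      inChart e Ω.form + extDeriv (inChart e (dc u)) := by
    filter_upwards [e.open_target.mem_nhds hy] with z hz
    rw [Pi.add_apply, ← inChart_ddc_eq_extDeriv he u hz]; rfl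
  have h1 : extDeriv (inChart e Ω.form) y = 0 := by
    rw [← inChart_extD he (fun c hc z hz =>
      (contDiffAt_inChart_form hc Ω hz).differentiableAt (by simp)) hy, inChart_eq he _ hy,
      Ω.closed]
    rfl
  have h2 : DifferentiableAt ℝ (extDeriv (inChart e (dc u))) y := by
    have h3 : extDeriv (inChart e (dc u)) =ᶠ[𝓝 y] fun y =>
        ddLin n (fderiv ℝ (fun z => dcLin n (fderiv ℝ (u ∘ e.symm) z)) y) := by
      filter_upwards [e.open_target.mem_nhds hy] with z hz
      rw [← inChart_ddc_eq_extDeriv he u hz, inChart_ddc he u hz]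
    refine DifferentiableAt.congr_of_eventuallyEq ?_ h3
    exact (ddLin n).differentiableAt.comp y
      (((contDiffAt_dcLin he u hy).fderiv_right (m := ∞) (by simp)).differentiableAt (by simp))
  rw [h.extDeriv_eq, extDeriv_add ((contDiffAt_inChart_form he Ω hy).differentiableAt (by simp)) h2,
    h1, extDeriv_extDeriv_apply (contDiffAt_inChart_dc he u hy)
      (by simpa [minSmoothness_of_isRCLikeNormedField] using ENat.LEInfty.out), add_zero]

lemma fderiv_dcLin_apply (hy : y ∈ e.target) (a b : Cn n) :
    fderiv ℝ (fun z => dcLin n (fderiv ℝ (u ∘ e.symm) z)) y a b =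
      -(1 / 2) * fderiv ℝ (fderiv ℝ (u ∘ e.symm)) y a (Complex.I • b) := by
  have h := (dcLin n).hasFDerivAt.comp y (((contDiffAt_chart he u hy).fderiv_right (m := ∞)
    (by simp)).differentiableAt (by simp)).hasFDerivAt
  have h2 : fderiv ℝ (fun z => dcLin n (fderiv ℝ (u ∘ e.symm) z)) y =
    (dcLin n).comp (fderiv ℝ (fderiv ℝ (u ∘ e.symm)) y) := h.fderiv
  rw [h2]
  rfl

/-- For dd^c u, invariance under multiplication by i comes from the symmetry of the second
derivative of `u`; for ω it is part of the definition of a Kähler form. -/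
lemma inChart_twist_smul_I (hy : y ∈ e.target) (v w : Cn n) :
    inChart e (Ω.twist u) y ![Complex.I • v, Complex.I • w] = inChart e (Ω.twist u) y ![v, w] := by
  have hII : ∀ v : Cn n, Complex.I • Complex.I • v = -v := fun v => by
    rw [smul_smul, Complex.I_mul_I, neg_one_smul]
  set x := e.symm y with hx
  have hc := chart_mem_atlas (Cn n) x
  have hyc : e.symm y ∈ (chartAt (Cn n) x).source := mem_chart_source _ x
  have hpair : ∀ v w : Cn n, inChart e Ω.form y ![v, w] =
      Ω.form x ![fderiv ℝ (chartAt (Cn n) x ∘ e.symm) y v,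
        fderiv ℝ (chartAt (Cn n) x ∘ e.symm) y w] := fun v w => by
    rw [inChart_eq he _ hy, ContinuousAlternatingMap.compContinuousLinearMap_apply]
    congr 1
    ext i j; fin_cases i <;> rfl
  have h1 : inChart e Ω.form y ![Complex.I • v, Complex.I • w] = inChart e Ω.form y ![v, w] := by
    rw [hpair, hpair, fderiv_transition_smul he hc hy hyc, fderiv_transition_smul he hc hy hyc]
    exact Ω.typeOneOne x _ _
  have hs : ∀ a b, fderiv ℝ (fderiv ℝ (u ∘ e.symm)) y a b =
      fderiv ℝ (fderiv ℝ (u ∘ e.symm)) y b a :=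
    (contDiffAt_chart he u hy).isSymmSndFDerivAt
      (by simpa [minSmoothness_of_isRCLikeNormedField] using ENat.LEInfty.out)
  rw [inChart_twist he Ω u hy, ContinuousAlternatingMap.add_apply,
    ContinuousAlternatingMap.add_apply, h1, ddLin_apply, ddLin_apply]
  simp only [fderiv_dcLin_apply he u hy, hII, map_neg]
  rw [hs (Complex.I • v) w, hs (Complex.I • w) v]
  ring

lemma topPower_inChart_twist_pos (hu : u ∈ Ω.potentials) (hy : y ∈ e.target) :
    0 < topPower n (inChart e (Ω.twist u) y) (stdFrame n) := by
  refine topPower_pos _ (inChart_twist_smul_I he Ω u hy) fun v hv => ?_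
  set x := e.symm y with hx
  have hc := chart_mem_atlas (Cn n) x
  have hyc : e.symm y ∈ (chartAt (Cn n) x).source := mem_chart_source _ x
  have h1 : inChart e (Ω.twist u) y ![v, Complex.I • v] =
      Ω.twist u x ![fderiv ℝ (chartAt (Cn n) x ∘ e.symm) y v,
        cplxJ x (fderiv ℝ (chartAt (Cn n) x ∘ e.symm) y v)] := by
    rw [inChart_eq he _ hy, ContinuousAlternatingMap.compContinuousLinearMap_apply]
    congr 1
    ext i j
    fin_cases i
    · rfl
    · exact congrArg (fun z : Cn n => z j) (fderiv_transition_smul he hc hy hyc Complex.I v)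
  rw [h1]
  exact hu x _ (fderiv_transition_injective he hc hy hyc hv)

end FormsInCharts

end KahlerPotentials

end

noncomputable section

open Set Filter MeasureTheory

namespace KahlerPotentials

/-! ### Gluing of the chart measures -/

section TopMeasure

variable {n : ℕ} {X : Type*} [TopologicalSpace X] [ChartedSpace (Cn n) X]
  [MeasurableSpace X] [BorelSpace X]

lemma chartMeasure_apply (e : OpenPartialHomeomorph X (Cn n)) (α : DiffForm n X 2) {A : Set X}
    (hA : MeasurableSet A) : chartMeasure e α A = ∫⁻ y in e.target ∩ e.symm ⁻¹' A,
      ENNReal.ofReal (topPower n (inChart e α y) (stdFrame n)) := by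
  have h1 : AEMeasurable e.symm ((volume.restrict e.target).withDensity
      fun y => ENNReal.ofReal (topPower n (inChart e α y) (stdFrame n))) :=
    (e.symm.continuousOn.aemeasurable e.open_target.measurableSet).mono_ac
      (withDensity_absolutelyContinuous _ _)
  rw [chartMeasure, Measure.map_apply_of_aemeasurable h1 hA, withDensity_apply',
    Measure.restrict_restrict' e.open_target.measurableSet, inter_comm]

lemma chartMeasure_apply_inter_source (e : OpenPartialHomeomorph X (Cn n)) (α : DiffForm n X 2)
    {A : Set X} (hA : MeasurableSet A) :
    chartMeasure e α (A ∩ e.source) = chartMeasure e α A := by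
  rw [chartMeasure_apply e α hA, chartMeasure_apply e α (hA.inter e.open_source.measurableSet)]
  congr 2
  ext y
  simp only [mem_inter_iff, mem_preimage]
  exact ⟨fun h => ⟨h.1, h.2.1⟩, fun h => ⟨h.1, h.2, e.map_target h.1⟩⟩

variable [IsManifold 𝓘(ℂ, Cn n) ∞ X]

/-- The measures in two charts agree on the intersection of the charts. -/
lemma chartMeasure_eq_of_subset {e c : OpenPartialHomeomorph X (Cn n)}
    (he : e ∈ atlas (Cn n) X) (hc : c ∈ atlas (Cn n) X) (α : DiffForm n X 2) {A : Set X}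
    (hA : MeasurableSet A) (hAe : A ⊆ e.source) (hAc : A ⊆ c.source) :
    chartMeasure c α A = chartMeasure e α A := by
  rw [chartMeasure_apply e α hA, chartMeasure_apply c α hA]
  set s := e.target ∩ e.symm ⁻¹' A with hs
  have hsm : MeasurableSet s := by
    have h := e.open_target.measurableSet.subtype_image
      ((continuousOn_iff_continuous_domRestrict.1 e.symm.continuousOn).measurable hA)
    convert h using 1
    ext y
    simp [hs, and_comm]
  have himg : (c ∘ e.symm) '' s = c.target ∩ c.symm ⁻¹' A := by
    ext z
    constructor
    · rintro ⟨y, ⟨hy, hyA⟩, rfl⟩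
      refine ⟨c.map_source (hAc hyA), ?_⟩
      simpa [c.left_inv (hAc hyA)] using hyA
    · rintro ⟨hz, hzA⟩
      refine ⟨e (c.symm z), ⟨e.map_source (hAe hzA), ?_⟩, ?_⟩
      · simpa [e.left_inv (hAe hzA)] using hzA
      · simp [e.left_inv (hAe hzA), c.right_inv hz]
  rw [← himg, lintegral_image_eq_lintegral_abs_det_fderiv_mul volume hsm
    (f' := fderiv ℝ (c ∘ e.symm))]
  · refine setLIntegral_congr_fun hsm fun y hy => ?_
    -- The Jacobian of the transition map is the factor by which the top power changes
    -- (`topPower_comp`).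
    have hd := det_fderiv_transition_pos he hc hy.1 (hAc hy.2)
    simp only [Function.comp_apply]
    rw [inChart_transition he hc α hy.1 (hAc hy.2), ← coe_stdBasis,
      topPower_comp, abs_of_pos hd, ENNReal.ofReal_mul hd.le]
  · exact fun y hy => ((contDiffAt_transition he hc hy.1 (hAc hy.2)).differentiableAt
      (by simp)).hasFDerivAt.hasFDerivWithinAt
  · intro y hy z hz hyz
    have h1 := c.injOn (hAc hy.2) (hAc hz.2) hyz
    exact e.symm.injOn hy.1 hz.1 h1

variable [CompactSpace X] [Nonempty X]

/-- The measure induced by a form restricts to the measures given in the charts. -/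
theorem restrict_topMeasure (α : DiffForm n X 2) {e : OpenPartialHomeomorph X (Cn n)}
    (he : e ∈ atlas (Cn n) X) : (topMeasure α).restrict e.source = chartMeasure e α := by
  obtain ⟨t, ht⟩ := isCompact_univ.elim_nhds_subcover (fun x : X => (chartAt (Cn n) x).source)
    fun x _ => chart_source_mem_nhds _ x
  have hne : (t : Set X).Nonempty := by
    obtain ⟨x⟩ := ‹Nonempty X›
    have hx := ht.2 (mem_univ x)
    simp only [mem_iUnion] at hx
    obtain ⟨y, hy, -⟩ := hx
    exact ⟨y, hy⟩
  obtain ⟨p, hp⟩ := t.countable_toSet.exists_eq_range hne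
  set S : ℕ → Set X := fun k => (chartAt (Cn n) (p k)).source with hS
  have hcover : ⋃ k, S k = univ := by
    refine eq_univ_of_univ_subset (ht.2.trans ?_)
    intro y hy
    simp only [mem_iUnion] at hy ⊢
    obtain ⟨x, hx, hy⟩ := hy
    obtain ⟨k, rfl⟩ : x ∈ range p := hp ▸ hx
    exact ⟨k, hy⟩
  have hSm : ∀ k, MeasurableSet (S k) := fun k => (chartAt (Cn n) (p k)).open_source.measurableSet
  set D := disjointed S with hD
  have hDm : ∀ k, MeasurableSet (D k) := fun k => MeasurableSet.disjointed hSm k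
  have hDS : ∀ k, D k ⊆ S k := fun k => disjointed_subset S k
  have hDU : ⋃ k, D k = univ := by rw [hD, iUnion_disjointed, hcover]
  -- A measure glued from disjoint pieces, each lying in one chart domain. Agreement of the chart
  -- measures on overlaps shows that it restricts correctly to every chart, and `topMeasure_eq`
  -- identifies it with `topMeasure α`.
  set ν := Measure.sum fun k => (chartMeasure (chartAt (Cn n) (p k)) α).restrict (D k) with hν
  have key : ∀ c ∈ atlas (Cn n) X, chartMeasure c α = ν.restrict c.source := by
    intro c hc
    ext A hA
    have hAc := hA.inter c.open_source.measurableSet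
    rw [Measure.restrict_apply hA, hν, Measure.sum_apply _ hAc,
      ← chartMeasure_apply_inter_source c α hA]
    have h1 : A ∩ c.source = ⋃ k, A ∩ c.source ∩ D k := by
      rw [← inter_iUnion, hDU, inter_univ]
    nth_rewrite 1 [h1]
    rw [measure_iUnion]
    · refine tsum_congr fun k => ?_
      rw [Measure.restrict_apply hAc]
      exact chartMeasure_eq_of_subset (chart_mem_atlas _ _) hc α (hAc.inter (hDm k))
        (inter_subset_right.trans (hDS k)) (inter_subset_left.trans inter_subset_right)
    · intro i j hij
      exact (disjoint_disjointed S hij).mono inter_subset_right inter_subset_right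
    · exact fun k => hAc.inter (hDm k)
  rw [topMeasure_eq α ν key, key e he]

end TopMeasure

end KahlerPotentials

end

noncomputable section

open Set Filter

/-! ### The C^∞ topology in terms of smooth families -/

section UniformOnFun

variable {T E F : Type*} [TopologicalSpace T] [TopologicalSpace E] [LocallyCompactSpace E]
  [UniformSpace F]

/-- On a compact neighbourhood of x the functions f s converge uniformly to f t as s → t, and f t is
continuous at x. -/
lemma continuousOn_uncurry_of_continuous_ofFun {U : Set E} (hU : IsOpen U) {f : T → E → F}
    (hf : Continuous fun t => UniformOnFun.ofFun {K : Set E | IsCompact K ∧ K ⊆ U} (f t))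
    (hc : ∀ t, ContinuousOn (f t) U) : ContinuousOn (fun p : T × E => f p.1 p.2) {p | p.2 ∈ U} := by
  rintro ⟨t, x⟩ hx
  refine ContinuousAt.continuousWithinAt ?_
  obtain ⟨K, hK, hxK, hKU⟩ := exists_compact_subset hU hx
  have h1 := UniformOnFun.tendsto_iff_tendstoUniformlyOn.1 (hf.tendsto t) K ⟨hK, hKU⟩
  refine tendsto_comp_of_locally_uniform_limit (f := f t) (F := fun p : T × E => f p.1)
    (g := fun p : T × E => p.2) (p := 𝓝 (t, x))
    ((hc t).continuousAt (hU.mem_nhds hx)) continuous_snd.continuousAt fun u hu =>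
      ⟨K, mem_interior_iff_mem_nhds.1 hxK, ?_⟩
  exact (continuous_fst.tendsto (t, x)).eventually (h1 u hu)

omit [LocallyCompactSpace E] in
-- Joint continuity makes f s close to f t near (t, y) for each y in the compact set; compactness
-- then makes the choice of s uniform.
lemma continuous_ofFun_of_continuousOn_uncurry {U : Set E} (hU : IsOpen U) {f : T → E → F}
    (hf : ContinuousOn (fun p : T × E => f p.1 p.2) {p | p.2 ∈ U}) :
    Continuous fun t => UniformOnFun.ofFun {K : Set E | IsCompact K ∧ K ⊆ U} (f t) := by
  refine continuous_iff_continuousAt.2 fun t => ?_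
  refine UniformOnFun.tendsto_iff_tendstoUniformlyOn.2 fun K hK u hu => ?_
  refine hK.1.eventually_forall_of_forall_eventually
    (P := fun s y => (f t y, f s y) ∈ u) fun y hy => ?_
  have hO : {p : T × E | p.2 ∈ U} ∈ 𝓝 (t, y) :=
    (hU.preimage continuous_snd).mem_nhds (hK.2 hy)
  have h1 : Tendsto (fun p : T × E => f p.1 p.2) (𝓝 (t, y)) (𝓝 (f t y)) :=
    (hf (t, y) (hK.2 hy)).continuousAt hO
  have h2 : Tendsto (fun p : T × E => f t p.2) (𝓝 (t, y)) (𝓝 (f t y)) :=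
    h1.comp (show Tendsto (fun p : T × E => (t, p.2)) (𝓝 (t, y)) (𝓝 (t, y)) from
      (by fun_prop : Continuous fun p : T × E => (t, p.2)).tendsto (t, y))
  exact (h2.prodMk_nhds h1) (nhds_le_uniformity (f t y) hu)

end UniformOnFun

namespace KahlerPotentials

section Topology

variable {n : ℕ} {X : Type*} [TopologicalSpace X] [ChartedSpace (Cn n) X]
  [IsManifold 𝓘(ℂ, Cn n) ∞ X] {T : Type*} [TopologicalSpace T]

/-- A family of smooth functions depends continuously on the parameter if and only if it is smooth
with parameters in every chart. -/
lemma continuous_smoothFun_iff {F : T → SmoothFun n X} : Continuous F ↔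
    ∀ e ∈ atlas (Cn n) X, ParamSmoothOn (fun t y => F t (e.symm y))
      {p : T × Cn n | p.2 ∈ e.target} := by
  simp only [continuous_iInf_rng, continuous_induced_rng]
  refine forall₂_congr fun e he => ⟨fun h => ?_, fun h k => ?_⟩
  · refine .of_continuousOn_iteratedFDeriv (fun p hp => contDiffAt_chart he (F p.1) hp) fun k => ?_
    refine continuousOn_uncurry_of_continuous_ofFun e.open_target (h k) fun t y hy => ?_
    refine ContinuousAt.continuousWithinAt ?_
    exact ((contDiffAt_chart he (F t) hy).iteratedFDeriv_right (m := 0) (i := k)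
      (by exact_mod_cast le_top)).continuousAt
  · exact continuous_ofFun_of_continuousOn_uncurry e.open_target (h k).continuousOn_iteratedFDeriv

/-- Smoothness of a family is local and survives composition with transition maps, so one convenient
chart around each point suffices. -/
lemma paramSmoothOn_chart_of_local {F : T → X → ℝ}
    (h : ∀ x, ∃ c ∈ atlas (Cn n) X, ∃ O : Set (Cn n), IsOpen O ∧ O ⊆ c.target ∧ x ∈ c.source ∧
      c x ∈ O ∧ ParamSmoothOn (fun t y => F t (c.symm y)) {p : T × Cn n | p.2 ∈ O})
    {e : OpenPartialHomeomorph X (Cn n)} (he : e ∈ atlas (Cn n) X) :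
    ParamSmoothOn (fun t y => F t (e.symm y)) {p : T × Cn n | p.2 ∈ e.target} := by
  intro k
  refine .of_local fun p hp => ?_
  obtain ⟨c, hc, O, hO, hOc, hxc, hxO, hF⟩ := h (e.symm p.2)
  have hU : IsOpen ((e.symm ≫ₕ c).source ∩ (e.symm ≫ₕ c) ⁻¹' O) :=
    (e.symm ≫ₕ c).isOpen_inter_preimage hO
  refine ⟨{p | p.2 ∈ (e.symm ≫ₕ c).source ∩ (e.symm ≫ₕ c) ⁻¹' O}, hU.preimage continuous_snd,
    ⟨by simpa [hxc] using hp, hxO⟩, ?_⟩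
  have hτ : ParamContDiffOn k (fun (_ : T) => c ∘ e.symm)
      {p | p.2 ∈ (e.symm ≫ₕ c).source ∩ (e.symm ≫ₕ c) ⁻¹' O} :=
    .of_contDiffOn hU (((contDiffOn_transition_complex he hc).restrict_scalars ℝ).mono
      inter_subset_left)
  refine ((hF k).comp hτ (hU.preimage continuous_snd) fun q hq => hq.2).congr
    (hU.preimage continuous_snd) fun q hq => ?_
  have : e.symm q.2 ∈ c.source := by simpa using hq.1.2
  simp [c.left_inv this]

/-- A family of functions that is locally smooth with parameters is a continuous family of smooth
functions. -/
lemma exists_continuous_smoothFun {F : T → X → ℝ}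
    (h : ∀ x, ∃ c ∈ atlas (Cn n) X, ∃ O : Set (Cn n), IsOpen O ∧ O ⊆ c.target ∧ x ∈ c.source ∧
      c x ∈ O ∧ ParamSmoothOn (fun t y => F t (c.symm y)) {p : T × Cn n | p.2 ∈ O}) :
    ∃ G : T → SmoothFun n X, Continuous G ∧ ∀ t x, G t x = F t x := by
  have hF := fun e he => paramSmoothOn_chart_of_local h (e := e) he
  have hs : ∀ t, ContMDiff 𝓘(ℝ, Cn n) 𝓘(ℝ, ℝ) ∞ (F t) := by
    intro t x
    have hx := mem_chart_source (Cn n) x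
    have hc := chart_mem_atlas (Cn n) x
    have h1 : ContMDiffAt 𝓘(ℝ, Cn n) 𝓘(ℝ, ℝ) ∞ (fun y => F t ((chartAt (Cn n) x).symm y))
        (chartAt (Cn n) x x) :=
      ((hF _ hc).contDiffAt (((chartAt (Cn n) x).open_target).preimage continuous_snd)
        ((chartAt (Cn n) x).map_source hx)).contMDiffAt
    have h2 := h1.comp x ((contMDiffOn_of_mem_maximalAtlas (I := 𝓘(ℝ, Cn n)) (n := ∞)
      (IsManifold.subset_maximalAtlas hc)).contMDiffAt
        ((chartAt (Cn n) x).open_source.mem_nhds hx))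
    refine h2.congr_of_eventuallyEq ?_
    filter_upwards [(chartAt (Cn n) x).open_source.mem_nhds hx] with z hz
    simp [(chartAt (Cn n) x).left_inv hz]
  exact ⟨fun t => ⟨F t, hs t⟩, continuous_smoothFun_iff.2 hF, fun t x => rfl⟩

end Topology

end KahlerPotentials

end

noncomputable section

open Set Filter

namespace KahlerPotentials

/-! ### Smooth dependence of densities and fluxes on the potentials -/

section ParametrisedForms

variable {n : ℕ} {T : Type*} [TopologicalSpace T] {W : Set (T × Cn n)}

lemma paramSmoothOn_pairing {α : T → Cn n → Cn n [⋀^Fin 2]→L[ℝ] ℝ} (hα : ParamSmoothOn α W)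
    (hW : IsOpen W) (a b : Cn n) : ParamSmoothOn (fun t y => α t y ![a, b]) W := fun k =>
  (hα k).clm_comp (ContinuousAlternatingMap.apply ℝ (Cn n) ℝ ![a, b]) hW

lemma paramSmoothOn_topPower {α : T → Cn n → Cn n [⋀^Fin 2]→L[ℝ] ℝ} (hα : ParamSmoothOn α W)
    (hW : IsOpen W) (e : Fin n × Fin 2 → Cn n) :
    ParamSmoothOn (fun t y => topPower n (α t y) e) W := fun k =>
  .mul (.of_param continuous_const) (.sum (fun _ _ => .mul (.of_param continuous_const)
    (.prod (fun _ _ => paramSmoothOn_pairing hα hW _ _ k) hW) hW) hW) hW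

lemma paramSmoothOn_divPotential {β : T → Cn n → Cn n →L[ℝ] ℝ}
    {θ θ' : T → Cn n → Cn n [⋀^Fin 2]→L[ℝ] ℝ} (hβ : ParamSmoothOn β W) (hθ : ParamSmoothOn θ W)
    (hθ' : ParamSmoothOn θ' W) (hW : IsOpen W) (e : Fin n × Fin 2 → Cn n) (p : Fin n × Fin 2) :
    ParamSmoothOn (fun t y => divPotential n (β t y) (θ t y) (θ' t y) e p) W := by
  intro k
  refine .mul (.of_param continuous_const) (.sum (fun i _ => .sum (fun σ _ => ?_) hW) hW) hW
  split_ifs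
  · refine .mul (.of_param continuous_const) (.mul (.of_param continuous_const) (.mul
      ((hβ k).clm_comp (ContinuousLinearMap.apply ℝ ℝ (e (σ (i, 1)))) hW)
      (.prod (fun j _ => ?_) hW) hW) hW) hW
    dsimp only
    split_ifs
    exacts [paramSmoothOn_pairing hθ' hW _ _ k, paramSmoothOn_pairing hθ hW _ _ k]
  · exact .zero

lemma divPotential_zero {V : Type} [NormedAddCommGroup V] [NormedSpace ℝ V]
    (θ θ' : V [⋀^Fin 2]→L[ℝ] ℝ) (e : Fin n × Fin 2 → V) (p : Fin n × Fin 2) :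
    divPotential n 0 θ θ' e p = 0 := by
  simp [divPotential, divTerm]

end ParametrisedForms

section Charts

variable {n : ℕ} {X : Type*} [TopologicalSpace X] [ChartedSpace (Cn n) X]
  [IsManifold 𝓘(ℂ, Cn n) ∞ X] {T : Type*} [TopologicalSpace T]
  {e : OpenPartialHomeomorph X (Cn n)} (he : e ∈ atlas (Cn n) X)

omit [ChartedSpace (Cn n) X] [IsManifold 𝓘(ℂ, Cn n) ∞ X] in
lemma isOpen_snd_target : IsOpen {p : T × Cn n | p.2 ∈ e.target} :=
  e.open_target.preimage continuous_snd

/-- The coefficient of `ω_vⁿ` in a chart. -/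
def KahlerForm.density (Ω : KahlerForm n X) (e : OpenPartialHomeomorph X (Cn n))
    (v : SmoothFun n X) (y : Cn n) : ℝ :=
  topPower n (inChart e (Ω.twist v) y) (stdFrame n)

/-- The components of a vector field with divergence `ω_{v+w}ⁿ - ω_vⁿ` in a chart. -/
def KahlerForm.flux (Ω : KahlerForm n X) (e : OpenPartialHomeomorph X (Cn n))
    (v w : SmoothFun n X) (p : Fin n × Fin 2) (y : Cn n) : ℝ :=
  divPotential n (dcLin n (fderiv ℝ (w ∘ e.symm) y)) (inChart e (Ω.twist v) y)
    (inChart e (Ω.twist (v + w)) y) (stdFrame n) p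

include he

lemma paramSmoothOn_dcLin {v : T → SmoothFun n X} (hv : Continuous v) :
    ParamSmoothOn (fun t y => dcLin n (fderiv ℝ (v t ∘ e.symm) y))
      {p : T × Cn n | p.2 ∈ e.target} := fun k =>
  ParamContDiffOn.clm_comp (dcLin n) ((continuous_smoothFun_iff.1 hv e he).fderiv k)
    isOpen_snd_target

variable (Ω : KahlerForm n X)

lemma paramSmoothOn_twist {v : T → SmoothFun n X} (hv : Continuous v) :
    ParamSmoothOn (fun t y => inChart e (Ω.twist (v t)) y)
      {p : T × Cn n | p.2 ∈ e.target} := by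
  intro k
  have h1 : ParamContDiffOn k (fun (_ : T) => inChart e Ω.form)
      {p : T × Cn n | p.2 ∈ e.target} := .of_contDiffOn e.open_target (Ω.smooth e he)
  have h2 : ParamContDiffOn k
      (fun t y => fderiv ℝ (fun z => dcLin n (fderiv ℝ (v t ∘ e.symm) z)) y)
      {p : T × Cn n | p.2 ∈ e.target} := (paramSmoothOn_dcLin he hv).fderiv k
  have h3 : ParamContDiffOn k
      (fun t y => ddLin n (fderiv ℝ (fun z => dcLin n (fderiv ℝ (v t ∘ e.symm) z)) y))
      {p : T × Cn n | p.2 ∈ e.target} := h2.clm_comp (ddLin n) isOpen_snd_target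
  have h4 := h1.add h3 isOpen_snd_target
  refine ParamContDiffOn.congr isOpen_snd_target h4 ?_
  intro p hp
  exact inChart_twist he Ω (v p.1) hp

lemma paramSmoothOn_density {v : T → SmoothFun n X} (hv : Continuous v) :
    ParamSmoothOn (fun t y => Ω.density e (v t) y) {p : T × Cn n | p.2 ∈ e.target} :=
  paramSmoothOn_topPower (paramSmoothOn_twist he Ω hv) isOpen_snd_target _

omit he in
lemma continuous_add_smoothFun {v w : T → SmoothFun n X} (hv : Continuous v)
    (hw : Continuous w) : Continuous fun t => v t + w t :=
  continuous_smoothFun_iff.2 fun e he k => (continuous_smoothFun_iff.1 hv e he k).add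
    (continuous_smoothFun_iff.1 hw e he k) isOpen_snd_target

lemma paramSmoothOn_flux {v w : T → SmoothFun n X} (hv : Continuous v) (hw : Continuous w)
    (p : Fin n × Fin 2) :
    ParamSmoothOn (fun t y => Ω.flux e (v t) (w t) p y) {p : T × Cn n | p.2 ∈ e.target} :=
  paramSmoothOn_divPotential (paramSmoothOn_dcLin he hw) (paramSmoothOn_twist he Ω hv)
    (paramSmoothOn_twist he Ω (continuous_add_smoothFun hv hw)) isOpen_snd_target _ p

lemma inChart_twist_add (v w : SmoothFun n X) {y : Cn n} (hy : y ∈ e.target) (a b : Cn n) :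
    inChart e (Ω.twist (v + w)) y ![a, b] = inChart e (Ω.twist v) y ![a, b] +
      (fderiv ℝ (fun z => dcLin n (fderiv ℝ (w ∘ e.symm) z)) y a b -
        fderiv ℝ (fun z => dcLin n (fderiv ℝ (w ∘ e.symm) z)) y b a) := by
  have h : (fun z => dcLin n (fderiv ℝ (⇑(v + w) ∘ e.symm) z)) =ᶠ[𝓝 y]
      fun z => dcLin n (fderiv ℝ (v ∘ e.symm) z) + dcLin n (fderiv ℝ (w ∘ e.symm) z) := by
    filter_upwards [e.open_target.mem_nhds hy] with z hz
    rw [← map_add]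
    congr 1
    exact fderiv_add ((contDiffAt_chart he v hz).differentiableAt (by simp))
      ((contDiffAt_chart he w hz).differentiableAt (by simp))
  rw [inChart_twist he Ω _ hy, inChart_twist he Ω _ hy, h.fderiv_eq,
    fderiv_fun_add ((contDiffAt_dcLin he v hy).differentiableAt (by simp))
      ((contDiffAt_dcLin he w hy).differentiableAt (by simp)), map_add, ← ddLin_apply]
  simp only [ContinuousAlternatingMap.add_apply]
  ring

/-- The forms ω_v and ω_{v+w} are closed and differ by d(d^c w), so `topPower_sub_eq_divergence`
applies with β = d^c w. -/
lemma density_add (v w : SmoothFun n X) {y : Cn n} (hy : y ∈ e.target) :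
    Ω.density e (v + w) y = Ω.density e v y +
      ∑ p, fderiv ℝ (Ω.flux e v w p) y (stdFrame n p) :=
  topPower_sub_eq_divergence ((contDiffAt_dcLin he w hy).differentiableAt (by simp))
    ((contDiffAt_inChart_twist he Ω v hy).differentiableAt (by simp))
    ((contDiffAt_inChart_twist he Ω _ hy).differentiableAt (by simp))
    (extDeriv_inChart_twist he Ω v hy) (extDeriv_inChart_twist he Ω _ hy)
    (inChart_twist_add he Ω v w hy) _

omit [IsManifold 𝓘(ℂ, Cn n) ∞ X] he in
-- The flux is linear in d^c w. It therefore vanishes off the support of `w`, which confines the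
-- rearranging map to that chart.
lemma flux_eq_zero (v : SmoothFun n X) {w : SmoothFun n X} {p : Fin n × Fin 2} {y : Cn n}
    (h : fderiv ℝ (w ∘ e.symm) y = 0) : Ω.flux e v w p y = 0 := by
  rw [KahlerForm.flux, h, map_zero, divPotential_zero]

omit [IsManifold 𝓘(ℂ, Cn n) ∞ X] he in
lemma fderiv_chart_eq_zero {w : SmoothFun n X} {K : Set X} (hK : IsClosed K)
    (hw : ∀ x ∉ K, w x = 0) {y : Cn n} (hy : y ∈ e.target) (hyK : e.symm y ∉ K) :
    fderiv ℝ (w ∘ e.symm) y = 0 := by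
  have h : w ∘ e.symm =ᶠ[𝓝 y] fun _ => 0 := by
    filter_upwards [(e.symm.continuousAt hy).preimage_mem_nhds (hK.isOpen_compl.mem_nhds hyK)]
      with z hz using hw _ hz
  rw [h.fderiv_eq]; simp

lemma density_add_of_notMem (v : SmoothFun n X) {w : SmoothFun n X} {K : Set X}
    (hK : IsClosed K) (hw : ∀ x ∉ K, w x = 0) {y : Cn n} (hy : y ∈ e.target)
    (hyK : e.symm y ∉ K) : Ω.density e (v + w) y = Ω.density e v y := by
  have h : ∀ p, Ω.flux e v w p =ᶠ[𝓝 y] fun _ => 0 := fun p => by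
    filter_upwards [e.open_target.mem_nhds hy,
      (e.symm.continuousAt hy).preimage_mem_nhds (hK.isOpen_compl.mem_nhds hyK)] with z hz hzK
    exact flux_eq_zero Ω v (fderiv_chart_eq_zero hK hw hz hzK)
  rw [density_add he Ω v w hy]
  simp [(h _).fderiv_eq]

lemma density_pos {u : SmoothFun n X} (hu : u ∈ Ω.potentials) {y : Cn n} (hy : y ∈ e.target) :
    0 < Ω.density e u y :=
  topPower_inChart_twist_pos he Ω u hu hy

end Charts

end KahlerPotentials

end

noncomputable section

open Set Filter MeasureTheory

/-! ### The transport theorem in an open set and measures in charts -/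

section LocalMoser

variable {T : Type*} [TopologicalSpace T] {E : Type} [NormedAddCommGroup E] [NormedSpace ℝ E]
  [MeasurableSpace E] [BorelSpace E] [FiniteDimensional ℝ E]

/-- A version of `exists_map_withDensity_sum` for densities that are only defined on an open set. -/
theorem exists_lintegral_preimage_eq (μ : Measure E) [μ.IsAddHaarMeasure] {ι : Type*}
    (s : Finset ι) {e : ι → E} {ℓ : ι → E →L[ℝ] ℝ} (he : ∀ i, ℓ i (e i) = 1)
    {U C K : Set E} (hU : IsOpen U) (hC : IsClosed C) (hK : IsCompact K) (hKU : K ⊆ U)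
    (hCK : C ⊆ interior K) {f : T → E → ℝ} {g : ι → T → E → ℝ}
    (hf : ParamSmoothOn f {p | p.2 ∈ U}) (hg : ∀ i, ParamSmoothOn (g i) {p | p.2 ∈ U})
    (hgC : ∀ i t, ∀ x ∈ U, x ∉ C → g i t x = 0)
    (hpos : ∀ u ⊆ s, ∀ t, ∀ x ∈ K, 0 < f t x + ∑ i ∈ u, fderiv ℝ (g i t) x (e i)) :
    ∃ φ : T → E → E, ParamSmoothOn φ univ ∧ (∀ t, Function.Injective (φ t)) ∧
      (∀ t, ∀ x ∉ C, φ t x = x) ∧ ∀ t, ∀ A ⊆ C, MeasurableSet A →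
        ∫⁻ x in φ t ⁻¹' A, ENNReal.ofReal (f t x) ∂μ =
          ∫⁻ x in A, ENNReal.ofReal (f t x + ∑ i ∈ s, fderiv ℝ (g i t) x (e i)) ∂μ := by
  classical
  obtain ⟨χ, hχ1, hχ0, hχI⟩ := exists_contMDiffMap_one_nhds_of_subset_interior (n := (⊤ : ℕ∞))
    𝓘(ℝ, E) hC hCK
  have hχC : ∀ x ∈ C, χ x = 1 := fun x hx => hχ1.self_of_nhdsSet x hx
  have hχ : ContDiff ℝ ∞ χ := χ.contMDiff.contDiff
  have hCU : C ⊆ U := (hCK.trans interior_subset).trans hKU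
  have hUo : IsOpen {p : T × E | p.2 ∈ U} := hU.preimage continuous_snd
  have hKo : IsOpen {p : T × E | p.2 ∉ K} := hK.isClosed.isOpen_compl.preimage continuous_snd
  have hCo : IsOpen {p : T × E | p.2 ∉ C} := hC.isOpen_compl.preimage continuous_snd
  -- The cutoff joins `f` to the constant 1, giving a positive density on all of `E` that equals `f`
  -- on `C`, the only place where mass is moved.
  set F : T → E → ℝ := fun t x => χ x * f t x + (1 - χ x) with hF
  set G : ι → T → E → ℝ := fun i t => C.indicator (g i t) with hG
  have hGU : ∀ i t, ∀ x ∈ U, G i t x = g i t x := fun i t x hx => by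
    by_cases hxC : x ∈ C
    · simp [hG, hxC]
    · simp [hG, hxC, hgC i t x hx hxC]
  have hGC : ∀ i t, ∀ x ∉ C, G i t x = 0 := fun i t x hx => indicator_of_notMem hx _
  have hFs : ParamSmoothOn F univ := by
    intro k
    refine .of_local fun p _ => ?_
    by_cases hp : p.2 ∈ U
    · exact ⟨_, hUo, hp, .add (.mul (.of_contDiff hχ) (hf k) hUo)
        (.of_contDiff (contDiff_const.sub hχ)) hUo⟩
    · refine ⟨_, hKo, fun h => hp (hKU h), ?_⟩
      refine ParamContDiffOn.congr (f := fun _ _ => (1 : ℝ)) hKo (.of_param continuous_const) ?_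
      intro q hq
      simp [hF, hχ0 q.2 hq]
  have hGs : ∀ i, ParamSmoothOn (G i) univ := by
    intro i k
    refine .of_local fun p _ => ?_
    by_cases hp : p.2 ∈ U
    · exact ⟨_, hUo, hp, (hg i k).congr hUo fun q hq => hGU i q.1 q.2 hq⟩
    · exact ⟨_, hCo, fun h => hp (hCU h), ParamContDiffOn.zero.congr hCo
        fun q hq => hGC i q.1 q.2 hq⟩
  have hdU : ∀ i t, ∀ x ∈ U, fderiv ℝ (G i t) x = fderiv ℝ (g i t) x := fun i t x hx =>
    Filter.EventuallyEq.fderiv_eq (by filter_upwards [hU.mem_nhds hx] with z hz using hGU i t z hz)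
  have hdC : ∀ i t, ∀ x ∉ C, fderiv ℝ (G i t) x = 0 := fun i t x hx => by
    have h : G i t =ᶠ[𝓝 x] fun _ => 0 := by
      filter_upwards [hC.isOpen_compl.mem_nhds hx] with z hz using hGC i t z hz
    rw [h.fderiv_eq]; simp
  have hlow : ∀ u ⊆ s, ∀ t, ∃ c > 0, ∀ x ∈ K, c ≤ f t x + ∑ i ∈ u, fderiv ℝ (g i t) x (e i) := by
    intro u hu t
    refine hK.exists_forall_le' ?_ (hpos u hu t)
    have hsum : ParamContDiffOn 0 (fun t x => f t x + ∑ i ∈ u, fderiv ℝ (g i t) x (e i))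
        {p | p.2 ∈ U} := (hf 0).add (.sum (fun i _ =>
          ((hg i).fderiv 0).clm_comp (ContinuousLinearMap.apply ℝ ℝ (e i)) hUo) hUo) hUo
    exact hsum.continuousOn.comp (f := fun x => (t, x)) (by fun_prop) fun x hx => hKU hx
  obtain ⟨φ, hφ, hinj, hφC, hmap⟩ := exists_map_withDensity_sum μ s he hFs hGs (K := C)
    (fun u hu t => by
      obtain ⟨c, hc, hcK⟩ := hlow u hu t
      obtain ⟨c', hc', hcK'⟩ := hlow ∅ (Finset.empty_subset s) t
      -- On `C` the density is the given one, bounded below by `c`. Off `C` the derivatives of `G`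
      -- vanish, and `F` is a convex combination of `f ≥ c'` and 1 on `K` and equals 1 off `K`.
      refine ⟨min c (min c' 1), by positivity, fun x => ?_⟩
      by_cases hxC : x ∈ C
      · have hxK := interior_subset (hCK hxC)
        simpa [hF, hχC x hxC, hdU _ _ x (hKU hxK)] using Or.inl (hcK x hxK)
      · simp only [hdC _ _ x hxC, hF, zero_apply, Finset.sum_const_zero,
          add_zero]
        refine (min_le_right _ _).trans ?_
        by_cases hxK : x ∈ K
        · have h1 := hcK' x hxK
          simp only [Finset.sum_empty, add_zero] at h1
          have h2 := hχI x
          nlinarith [h2.1, h2.2, min_le_left c' 1, min_le_right c' 1,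
            mul_le_mul_of_nonneg_left ((min_le_left c' 1).trans h1) h2.1,
            mul_le_mul_of_nonneg_left (min_le_right c' 1) (sub_nonneg.2 h2.2)]
        · simp [hχ0 x hxK]) hGC
  refine ⟨φ, hφ, hinj, hφC, fun t A hAC hA => ?_⟩
  have hφm : Measurable (φ t) :=
    (hφ.continuous.comp (by fun_prop : Continuous fun x : E => (t, x))).measurable
  -- Points outside `C` are fixed, so no point outside `C` is mapped into `A`; both integrals only
  -- see the region where `F` is `f`.
  have hpre : φ t ⁻¹' A ⊆ C := fun x hx => by
    by_contra hxC
    exact hxC (hAC (by simpa [hφC t x hxC] using hx))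
  have h := congrArg (fun ν : Measure E => ν A) (hmap t)
  simp only [Measure.map_apply hφm hA, withDensity_apply _ hA,
    withDensity_apply _ (hφm hA)] at h
  rw [setLIntegral_congr_fun hA (g := fun x =>
      ENNReal.ofReal (f t x + ∑ i ∈ s, fderiv ℝ (g i t) x (e i))),
    setLIntegral_congr_fun (hφm hA) (g := fun x => ENNReal.ofReal (f t x))] at h
  · exact h
  · intro x hx
    simp [hF, hχC x (hpre hx)]
  · intro x hx
    simp [hF, hχC x (hAC hx), hdU _ _ x (hCU (hAC hx))]

end LocalMoser

namespace KahlerPotentials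

section MeasureInCharts

variable {n : ℕ} {X : Type*} [TopologicalSpace X] [ChartedSpace (Cn n) X]
  [IsManifold 𝓘(ℂ, Cn n) ∞ X] [MeasurableSpace X] [BorelSpace X]
  [CompactSpace X] [Nonempty X] (Ω : KahlerForm n X)

omit [ChartedSpace (Cn n) X] [IsManifold 𝓘(ℂ, Cn n) ∞ X] [CompactSpace X] [Nonempty X] in
lemma measurableSet_target_inter_preimage {e : OpenPartialHomeomorph X (Cn n)} {A : Set X}
    (hA : MeasurableSet A) : MeasurableSet (e.target ∩ e.symm ⁻¹' A) := by
  have h := e.open_target.measurableSet.subtype_image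
    ((continuousOn_iff_continuous_domRestrict.1 e.symm.continuousOn).measurable hA)
  convert h using 1
  ext y
  simp [and_comm]

lemma measure_eq_lintegral {e : OpenPartialHomeomorph X (Cn n)} (he : e ∈ atlas (Cn n) X)
    (u : SmoothFun n X) {A : Set X} (hA : MeasurableSet A) (hAe : A ⊆ e.source) :
    Ω.measure u A = ∫⁻ y in e.target ∩ e.symm ⁻¹' A, ENNReal.ofReal (Ω.density e u y) := by
  rw [KahlerForm.measure, ← Measure.restrict_eq_self (topMeasure (Ω.twist u)) hAe,
    restrict_topMeasure (Ω.twist u) he, chartMeasure_apply e _ hA]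
  rfl

/-- The measures of `v` and `v + w` agree where `w` vanishes. -/
lemma measure_add_of_disjoint (v : SmoothFun n X) {w : SmoothFun n X} {K : Set X}
    (hK : IsClosed K) (hw : ∀ x ∉ K, w x = 0) {A : Set X} (hA : MeasurableSet A)
    (hAK : Disjoint A K) : Ω.measure (v + w) A = Ω.measure v A := by
  obtain ⟨t, ht⟩ := isCompact_univ.elim_nhds_subcover (fun x : X => (chartAt (Cn n) x).source)
    fun x _ => chart_source_mem_nhds _ x
  have hU : (⋃ x : t, (chartAt (Cn n) (x : X)).source) = univ := by
    ext y
    simpa using ht.2 (mem_univ y)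
  have key : (Ω.measure (v + w)).restrict A = (Ω.measure v).restrict A := by
    rw [Measure.ext_iff_of_iUnion_eq_univ hU]
    intro x
    have hs := (chartAt (Cn n) (x : X)).open_source.measurableSet
    have hc := chart_mem_atlas (Cn n) (x : X)
    ext B hB
    simp only [Measure.restrict_apply hB, Measure.restrict_apply (hB.inter hs)]
    have hm := (hB.inter hs).inter hA
    have hsub : B ∩ (chartAt (Cn n) (x : X)).source ∩ A ⊆ (chartAt (Cn n) (x : X)).source :=
      fun z hz => hz.1.2
    rw [measure_eq_lintegral Ω hc _ hm hsub, measure_eq_lintegral Ω hc _ hm hsub]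
    refine setLIntegral_congr_fun (measurableSet_target_inter_preimage hm) fun y hy => ?_
    exact congrArg ENNReal.ofReal (density_add_of_notMem hc Ω v hK hw hy.1
      (disjoint_left.1 hAK hy.2.2))
  have h := congrArg (fun ν : Measure X => ν A) key
  simpa using h

end MeasureInCharts

end KahlerPotentials

end

noncomputable section

open Set Filter MeasureTheory

namespace KahlerPotentials

/-! ### Rearrangement for a perturbation supported in one chart -/

section Rearrangement

variable {n : ℕ} {X : Type*} [TopologicalSpace X] [T2Space X] [CompactSpace X] [Nonempty X]
  [ChartedSpace (Cn n) X] [IsManifold 𝓘(ℂ, Cn n) ∞ X] [MeasurableSpace X] [BorelSpace X]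
  {T : Type*} [TopologicalSpace T]

/-- If `w` is small and supported in the domain of a chart, then every continuous family `η` of
smooth functions on `(X, μ_{v+w})` has a continuous family of strict rearrangements on
`(X, μ_v)`. -/
theorem exists_equidistributed_add (Ω : KahlerForm n X) {e : OpenPartialHomeomorph X (Cn n)}
    (he : e ∈ atlas (Cn n) X) {v w η : T → SmoothFun n X} (hv : Continuous v) (hw : Continuous w)
    (hη : Continuous η) {K : Set X} (hK : IsCompact K) (hKe : K ⊆ e.source)
    (hwK : ∀ t, ∀ x ∉ K, w t x = 0) {K' : Set (Cn n)} (hK' : IsCompact K')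
    (hK'e : K' ⊆ e.target) (hKK' : e '' K ⊆ interior K')
    (hpos : ∀ t, ∀ S : Finset (Fin n × Fin 2), ∀ y ∈ K', 0 < Ω.density e (v t) y +
      ∑ p ∈ S, fderiv ℝ (Ω.flux e (v t) (w t) p) y (stdFrame n p)) :
    ∃ η' : T → SmoothFun n X, Continuous η' ∧
      ∀ t, Equidistributed (Ω.measure (v t + w t)) (Ω.measure (v t)) (η t) (η' t) := by
  classical
  have hmem : ∀ y, y ∈ e '' K ↔ y ∈ e.target ∧ e.symm y ∈ K := fun y => by
    constructor
    · rintro ⟨x, hx, rfl⟩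
      exact ⟨e.map_source (hKe hx), by rwa [e.left_inv (hKe hx)]⟩
    · rintro ⟨hy, hyK⟩
      exact ⟨_, hyK, e.right_inv hy⟩
  have hC : IsCompact (e '' K) := hK.image_of_continuousOn (e.continuousOn.mono hKe)
  obtain ⟨φ, hφ, hinj, hφC, hint⟩ := exists_lintegral_preimage_eq (volume : Measure (Cn n))
    Finset.univ (e := stdFrame n)
    (ℓ := fun p => LinearMap.toContinuousLinearMap ((stdBasis n).coord p))
    (fun p => by simp [← coe_stdBasis]) e.open_target hC.isClosed hK' hK'e hKK'
    (paramSmoothOn_density he Ω hv) (fun p => paramSmoothOn_flux he Ω hv hw p)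
    (fun p t y hy hyC => flux_eq_zero Ω (v t) (fderiv_chart_eq_zero hK.isClosed (hwK t) hy
      fun h => hyC ((hmem y).2 ⟨hy, h⟩)))
    (fun S _ t y hy => hpos t S y hy)
  have hφmem : ∀ t y, φ t y ∈ e '' K ↔ y ∈ e '' K := fun t y => by
    constructor
    · intro h
      by_contra hy
      exact hy (by rwa [hφC t y hy] at h)
    · intro h
      by_contra hy
      exact hy ((hinj t (hφC t _ hy)).symm ▸ h)
  have hφt : ∀ t, ∀ y ∈ e.target, φ t y ∈ e.target := fun t y hy => by
    by_cases h : y ∈ e '' K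
    · exact ((hmem _).1 ((hφmem t y).2 h)).1
    · rwa [hφC t y h]
  -- The map that pushes μ_v to μ_{v+w}, extended by the identity. It is already the identity off
  -- `K`, so η ∘ Φ is smooth across the boundary of the chart domain.
  set Φ : T → X → X := fun t x => if x ∈ e.source then e.symm (φ t (e x)) else x with hΦ
  have hΦe : ∀ t, ∀ y ∈ e.target, Φ t (e.symm y) = e.symm (φ t y) := fun t y hy => by
    simp [hΦ, e.map_target hy, e.right_inv hy]
  have hΦK : ∀ t, ∀ x ∉ K, Φ t x = x := fun t x hx => by
    by_cases hxe : x ∈ e.source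
    · have : e x ∉ e '' K := fun h => hx (by simpa [e.left_inv hxe] using ((hmem _).1 h).2)
      simp [hΦ, hxe, hφC t _ this, e.left_inv hxe]
    · simp [hΦ, hxe]
  obtain ⟨η', hη', hηΦ⟩ := exists_continuous_smoothFun (F := fun t x => η t (Φ t x)) fun x => by
    by_cases hx : x ∈ K
    · refine ⟨e, he, e.target, e.open_target, subset_rfl, hKe hx, e.map_source (hKe hx),
        fun k => ?_⟩
      exact ((continuous_smoothFun_iff.1 hη e he k).comp ((hφ k).mono (subset_univ _))
        isOpen_snd_target fun p hp => hφt p.1 p.2 hp).congr isOpen_snd_target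
        fun p hp => by rw [hΦe p.1 p.2 hp]
    · set c := chartAt (Cn n) x with hc
      have hcm : c ∈ atlas (Cn n) X := chart_mem_atlas _ _
      have hxc : x ∈ c.source := mem_chart_source _ x
      have hO : IsOpen (c.target ∩ c.symm ⁻¹' Kᶜ) :=
        c.symm.isOpen_inter_preimage hK.isClosed.isOpen_compl
      refine ⟨c, hcm, c.target ∩ c.symm ⁻¹' Kᶜ, hO, inter_subset_left, hxc,
        ⟨c.map_source hxc, by simpa [c.left_inv hxc] using hx⟩, fun k => ?_⟩
      exact ((continuous_smoothFun_iff.1 hη c hcm k).mono fun p hp => hp.1).congr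
        (hO.preimage continuous_snd) fun p hp => by rw [hΦK p.1 _ hp.2]
  refine ⟨η', hη', fun t B hB => ?_⟩
  have hm : MeasurableSet (η t ⁻¹' B) := (η t).contMDiff.continuous.measurable hB
  have hm' : MeasurableSet (η' t ⁻¹' B) := (η' t).contMDiff.continuous.measurable hB
  have hKm := hK.isClosed.measurableSet
  -- Inside `K` the transport identity in the chart applies. Outside `K` the preimages under `η` and
  -- `η'` coincide, and the two measures agree since `w` vanishes there.
  rw [← measure_inter_add_sdiff (η t ⁻¹' B) hKm, ← measure_inter_add_sdiff (η' t ⁻¹' B) hKm]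
  congr 1
  · rw [measure_eq_lintegral Ω he _ (hm.inter hKm) (inter_subset_right.trans hKe),
      measure_eq_lintegral Ω he _ (hm'.inter hKm) (inter_subset_right.trans hKe)]
    have hA := measurableSet_target_inter_preimage (e := e) (hm.inter hKm)
    have hpre : e.target ∩ e.symm ⁻¹' (η' t ⁻¹' B ∩ K) =
        φ t ⁻¹' (e.target ∩ e.symm ⁻¹' (η t ⁻¹' B ∩ K)) := by
      ext y
      have h1 := hφmem t y
      rw [hmem, hmem] at h1
      simp only [mem_inter_iff, mem_preimage]
      constructor
      · rintro ⟨hy, hyB, hyK⟩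
        obtain ⟨h2, h3⟩ := h1.2 ⟨hy, hyK⟩
        exact ⟨h2, by rwa [hηΦ, hΦe t y hy] at hyB, h3⟩
      · rintro ⟨hy, hyB, hyK⟩
        obtain ⟨h2, h3⟩ := h1.1 ⟨hy, hyK⟩
        exact ⟨h2, by rwa [hηΦ, hΦe t y h2], h3⟩
    rw [hpre, hint t _ (fun y hy => (hmem y).2 ⟨hy.1, hy.2.2⟩) hA]
    exact setLIntegral_congr_fun hA fun y hy =>
      congrArg ENNReal.ofReal (density_add he Ω (v t) (w t) hy.1)
  · have hdiff : η' t ⁻¹' B \ K = η t ⁻¹' B \ K := by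
      ext x
      simp only [Set.mem_sdiff, mem_preimage]
      refine and_congr_left fun hx => ?_
      rw [hηΦ, hΦK t x hx]
    rw [hdiff]
    exact measure_add_of_disjoint Ω (v t) hK.isClosed (hwK t) (hm.diff hKm) disjoint_sdiff_left

end Rearrangement

end KahlerPotentials

end

noncomputable section

open Set Filter MeasureTheory

namespace KahlerPotentials

/-! ### Fragmentation by a partition of unity and the local theorem -/

section Fragmentation

variable {n : ℕ} {X : Type*} [TopologicalSpace X] [ChartedSpace (Cn n) X]
  [IsManifold 𝓘(ℂ, Cn n) ∞ X] {T : Type*} [TopologicalSpace T]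

lemma continuous_const_mul_smoothFun (a : SmoothFun n X) {v : T → SmoothFun n X}
    (hv : Continuous v) : Continuous fun t => a * v t :=
  continuous_smoothFun_iff.2 fun e he k => .mul
    (.of_contDiffOn e.open_target (contDiffOn_chart he a)) (continuous_smoothFun_iff.1 hv e he k)
    isOpen_snd_target

lemma continuous_sum_smoothFun {ι : Type*} (s : Finset ι) {v : ι → T → SmoothFun n X}
    (hv : ∀ i, Continuous (v i)) : Continuous fun t => ∑ i ∈ s, v i t := by
  classical
  induction s using Finset.induction_on with
  | empty => simpa using continuous_const
  | insert i s hi ih => simpa [Finset.sum_insert hi] using continuous_add_smoothFun (hv i) ih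

/-- For a small perturbation `w`, the densities at all intermediate steps are positive. -/
lemma eventually_density_add_flux_pos (Ω : KahlerForm n X) {e : OpenPartialHomeomorph X (Cn n)}
    (he : e ∈ atlas (Cn n) X) {v w : T → SmoothFun n X} (hv : Continuous v) (hw : Continuous w)
    {K : Set (Cn n)} (hK : IsCompact K) (hKe : K ⊆ e.target) {t₀ : T}
    (hv₀ : v t₀ ∈ Ω.potentials) (hw₀ : w t₀ = 0) (S : Finset (Fin n × Fin 2)) :
    ∀ᶠ t in 𝓝 t₀, ∀ y ∈ K, 0 < Ω.density e (v t) y +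
      ∑ p ∈ S, fderiv ℝ (Ω.flux e (v t) (w t) p) y (stdFrame n p) := by
  refine hK.eventually_forall_of_forall_eventually (P := fun t y => 0 < Ω.density e (v t) y +
      ∑ p ∈ S, fderiv ℝ (Ω.flux e (v t) (w t) p) y (stdFrame n p)) fun y hy => ?_
  have hs : ParamContDiffOn 0 (fun t y => Ω.density e (v t) y +
      ∑ p ∈ S, fderiv ℝ (Ω.flux e (v t) (w t) p) y (stdFrame n p))
      {p : T × Cn n | p.2 ∈ e.target} :=
    (paramSmoothOn_density he Ω hv 0).add (.sum (fun p _ =>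
      ((paramSmoothOn_flux he Ω hv hw p).fderiv 0).clm_comp
        (ContinuousLinearMap.apply ℝ ℝ (stdFrame n p)) isOpen_snd_target)
        isOpen_snd_target) isOpen_snd_target
  have hc := (hs.continuousOn (t₀, y) (hKe hy)).continuousAt
    (isOpen_snd_target.mem_nhds (hKe hy))
  refine hc.eventually_mem (isOpen_Ioi.mem_nhds ?_)
  -- At `t₀` the perturbation is zero, so only the positive density of a form in 𝓗 remains.
  have hflux : ∀ p, Ω.flux e (v t₀) (w t₀) p = fun _ => 0 := fun p => by
    funext z
    refine flux_eq_zero Ω _ ?_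
    rw [hw₀]
    exact fderiv_const_apply (0 : ℝ)
  simpa [hflux] using density_pos he Ω hv₀ (hKe hy)

lemma Equidistributed.trans {Y Z W : Type*} [MeasurableSpace Y] [MeasurableSpace Z]
    [MeasurableSpace W] {μ : Measure Y} {ν : Measure Z} {τ : Measure W} {ξ : Y → ℝ} {η : Z → ℝ}
    {ζ : W → ℝ} (h : Equidistributed μ ν ξ η) (h' : Equidistributed ν τ η ζ) :
    Equidistributed μ τ ξ ζ := fun B hB => (h B hB).trans (h' B hB)

variable [T2Space X] [CompactSpace X]

variable (X) in
/-- A finite smooth partition of unity subordinate to charts. -/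
lemma exists_finite_partition_charts : ∃ (ι : Type) (_ : Fintype ι) (ρ : ι → SmoothFun n X)
    (c : ι → OpenPartialHomeomorph X (Cn n)), ∑ i, ρ i = 1 ∧ ∀ i, c i ∈ atlas (Cn n) X ∧
      tsupport (ρ i) ⊆ (c i).source := by
  obtain ⟨t, ht⟩ := isCompact_univ.elim_nhds_subcover (fun x : X => (chartAt (Cn n) x).source)
    fun x _ => chart_source_mem_nhds _ x
  obtain ⟨ρ, hρ⟩ := SmoothPartitionOfUnity.exists_isSubordinate 𝓘(ℝ, Cn n) isClosed_univ
    (fun x : t => (chartAt (Cn n) (x : X)).source)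
    (fun x => (chartAt (Cn n) (x : X)).open_source)
    (by simpa [iUnion_subtype] using ht)
  refine ⟨Fin t.card, inferInstance, fun i => ρ (t.equivFin.symm i),
    fun i => chartAt (Cn n) (t.equivFin.symm i : X), ?_, fun i => ⟨chart_mem_atlas _ _, hρ _⟩⟩
  rw [Equiv.sum_comp t.equivFin.symm fun i => (ρ i : SmoothFun n X)]
  ext x
  have h := ρ.sum_eq_one (mem_univ x)
  rw [finsum_eq_sum_of_fintype] at h
  refine Eq.trans ?_ h
  exact map_sum ({ toFun := fun f => f x, map_zero' := rfl, map_add' := fun _ _ => rfl } :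
    SmoothFun n X →+ ℝ) _ _

variable [MeasurableSpace X] [BorelSpace X] [Nonempty X]

/-- Near a point of `T𝓗`, the functions `ξ` on `(X, μ_u)` have strict rearrangements on a fixed
space `(X, μ_{u₀})` that depend continuously on `(u, ξ)`. -/
theorem exists_equidistributed_nhds (Ω : KahlerForm n X) (τ₀ : Ω.TH) :
    ∃ N ∈ 𝓝 τ₀, ∃ η : N → SmoothFun n X, Continuous η ∧ ∀ τ : N,
      Equidistributed (Ω.measure τ.1.1) (Ω.measure τ₀.1) τ.1.2 (η τ) := by
  classical
  obtain ⟨ι, _, ρ, c, hρ1, hρ⟩ := exists_finite_partition_charts (n := n) X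
  have hKc : ∀ i, IsCompact (tsupport (ρ i)) := fun i => (isClosed_tsupport _).isCompact
  have hbt : ∀ i, ∃ K', IsCompact K' ∧ c i '' tsupport (ρ i) ⊆ interior K' ∧ K' ⊆ (c i).target :=
    fun i => exists_compact_between
      ((hKc i).image_of_continuousOn ((c i).continuousOn.mono (hρ i).2)) (c i).open_target
      (image_subset_iff.2 fun x hx => (c i).map_source ((hρ i).2 hx))
  choose K' hK' hKK' hK't using hbt
  set d : Ω.TH → SmoothFun n X := fun τ => τ.1.1 + -τ₀.1.1 with hd
  have hdc : Continuous d :=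
    continuous_add_smoothFun (continuous_subtype_val.comp continuous_fst) continuous_const
  -- These partial sums interpolate between u₀ (empty set) and u (all indices), with increments
  -- supported in single charts. They are not required to lie in 𝓗: only positivity of the densities
  -- in the relevant charts enters.
  set v : Finset ι → Ω.TH → SmoothFun n X := fun S τ => τ₀.1.1 + ∑ i ∈ S, ρ i * d τ with hv
  have hwc : ∀ i, Continuous fun τ => ρ i * d τ := fun i => continuous_const_mul_smoothFun _ hdc
  have hvc : ∀ S, Continuous (v S) := fun S =>
    continuous_add_smoothFun continuous_const (continuous_sum_smoothFun S hwc)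
  have hd0 : d τ₀ = 0 := by simp [hd]
  have hev : ∀ᶠ τ in 𝓝 τ₀, ∀ i S P, ∀ y ∈ K' i, 0 < Ω.density (c i) (v S τ) y +
      ∑ p ∈ P, fderiv ℝ (Ω.flux (c i) (v S τ) (ρ i * d τ) p) y (stdFrame n p) := by
    simp only [eventually_all]
    intro i S P
    refine eventually_density_add_flux_pos Ω (hρ i).1 (hvc S) (hwc i) (hK' i) (hK't i) ?_ ?_ P
    · simp [hv, hd0]
    · simp [hd0]
  refine ⟨_, hev, ?_⟩
  set N : Set Ω.TH := {τ | ∀ i S P, ∀ y ∈ K' i, 0 < Ω.density (c i) (v S τ) y +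
      ∑ p ∈ P, fderiv ℝ (Ω.flux (c i) (v S τ) (ρ i * d τ) p) y (stdFrame n p)} with hN
  -- The induction removes one increment at a time. It is stated for arbitrary families `η` because
  -- each step hands a new family to the next.
  have key : ∀ S : Finset ι, ∀ η : N → SmoothFun n X, Continuous η →
      ∃ η' : N → SmoothFun n X, Continuous η' ∧ ∀ τ : N,
        Equidistributed (Ω.measure (v S τ)) (Ω.measure τ₀.1) (η τ) (η' τ) := by
    intro S
    induction S using Finset.induction_on with
    | empty =>
      intro η hη
      exact ⟨η, hη, fun τ B _ => by simp [hv]⟩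
    | insert i S hi ih =>
      intro η hη
      obtain ⟨η₁, hη₁, h₁⟩ := exists_equidistributed_add Ω (hρ i).1
        (v := fun τ : N => v S τ) (w := fun τ : N => ρ i * d τ)
        ((hvc S).comp continuous_subtype_val) ((hwc i).comp continuous_subtype_val) hη (hKc i)
        (hρ i).2 (fun τ x hx => by
          have : ρ i x = 0 := image_eq_zero_of_notMem_tsupport hx
          simp [this]) (hK' i) (hK't i) (hKK' i) fun τ P y hy => τ.2 i S P y hy
      obtain ⟨η₂, hη₂, h₂⟩ := ih η₁ hη₁
      refine ⟨η₂, hη₂, fun τ => ?_⟩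
      have hins : v (insert i S) τ = v S τ + ρ i * d τ := by
        simp only [hv, Finset.sum_insert hi]
        abel
      rw [hins]
      exact (h₁ τ).trans (h₂ τ)
  obtain ⟨η, hη, h⟩ := key Finset.univ (fun τ => τ.1.2)
    (continuous_snd.comp continuous_subtype_val)
  refine ⟨η, hη, fun τ => ?_⟩
  have huniv : v Finset.univ τ = τ.1.1 := by
    simp only [hv, hd]
    rw [← Finset.sum_mul, hρ1, one_mul]
    abel
  have := h τ
  rwa [huniv] at this

end Fragmentation

end KahlerPotentials

end

theorem theorem2p5 (n : ℕ) (X : Type*) [TopologicalSpace X] [T2Space X] [CompactSpace X]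
    [ConnectedSpace X] [ChartedSpace (KahlerPotentials.Cn n) X]
    [IsManifold 𝓘(ℂ, KahlerPotentials.Cn n) ∞ X] [MeasurableSpace X] [BorelSpace X]
    (Ω : KahlerPotentials.KahlerForm n X) (L : Ω.TH → ℝ)
    (hL : KahlerPotentials.IsInvariantConvexLagrangian Ω L) :
    Continuous L := by
  refine continuous_iff_continuousAt.2 fun τ₀ => ?_
  obtain ⟨N, hN, η, hη, h⟩ := KahlerPotentials.exists_equidistributed_nhds Ω τ₀
  -- Near `τ₀` the Lagrangian factors through the fibre over the fixed base point, composed with the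
  -- continuous family `η`.
  have hLN : N.domRestrict L = fun τ => L (τ₀.1, η τ) := by
    funext τ
    exact hL.invariant τ.1.1 τ₀.1 τ.1.2 (η τ) (h τ)
  have hc : ContinuousOn L N := by
    rw [continuousOn_iff_continuous_domRestrict, hLN]
    exact (hL.continuous_fiber τ₀.1).comp hη
  exact hc.continuousAt hN
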